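/- Let $p$ be a prime, $G$ a finite group, and $L/K$ a finite Galois extension of fields of characteristic $p$ with Galois group $\Gamma$, acting on $LG$ through the coefficients. For $k\in\{K,L\}$ and a subgroup $H\le G$, a *block idempotent* of $kH$ is a primitive idempotent of the centre $Z(kH)$. For a $p$-subgroup $P\le G$, let $\mathrm{Br}_P$ denote the $k$-linear projection of $kG$ onto $kC_G(P)$ deleting the coefficients outside $C_G(P)$. A *$kG$-Brauer pair* is a pair $(P,e)$ with $P$ a $p$-subgroup of $G$ and $e$ a block idempotent of $kC_G(P)$; it is a *$(kG,b)$-Brauer pair*, or *$kGb$-Brauer pair*, for a block idempotent $b$ of $kG$ if $\mathrm{Br}_P(b)e=e$. One writes $(Q,f)\le(P,e)$ if $Q\le P$ and every primitive idempotent $i$ of $(kG)^P$ with $e\,\mathrm{Br}_P(i)=\mathrm{Br}_P(i)\ne0$ satisfies $f\,\mathrm{Br}_Q(i)=\mathrm{Br}_Q(i)\neq 0$. Write $c_x$ for conjugation $g\mapsto xgx^{-1}$ and for its linear extension to $kG$, put ${}^x(Q,f)=(xQx^{-1},c_x(f))$, and let $N_G(Q,f)$ be the stabilizer of $(Q,f)$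 in $G$. If $(P,e)$ is a maximal $(kG,b)$-Brauer pair, then for $Q\le P$ let $e_Q$ be the unique block idempotent of $kC_G(Q)$ with $(Q,e_Q)\le(P,e)$. The fusion system $\mathcal F_{(P,e)}(kGb)$ has as objects the subgroups of $P$, and its morphisms $Q\to R$ are the group homomorphisms $\varphi\colon Q\to R$ for which there is $x\in G$ with $\varphi(u)=xux^{-1}$ for all $u\in Q$ and ${}^x(Q,e_Q)\le(R,e_R)$. A *fusion system* over $P$ is a category whose objects are the subgroups of $P$, whose morphisms are injective group homomorphisms composed as functions, including all homomorphisms induced by conjugation with elements of $P$, and such that for every morphism $\varphi\colon Q\to R$ the isomorphism $Q\to\varphi(Q)$ and its inverse are morphisms. For a subsystem $\mathcal F$ and $\sigma\in\mathrm{Aut}(P)$, $\langle\mathcal F,\sigma\rangle$ is the intersection of all fusion systems over $P$ containing $\mathcal F$ and $\sigma$. For a block idempotent $b$ of $LG$ (respectively $e$ of $LC_G(P)$) let $\tilde b$ (respectively $\tilde e$) be the sum of its distinct $\Gamma$-conjugates, an element of $KG$. **Theorem.** Let $b$ be a block idempotent of $LG$ and $(P,e)$ a maximal $LGb$-Brauer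 pair. Then $\tilde b$ is a block idempotent of $KG$, $(P,\tilde e)$ is a maximal $KG\tilde b$-Brauer pair, and $N_G(P,e)$ is a normal subgroup of $N_G(P,\tilde e)$ with cyclic quotient. Set $\mathcal F=\mathcal F_{(P,e)}(LGb)$ and $\tilde{\mathcal F}=\mathcal F_{(P,\tilde e)}(KG\tilde b)$. Let $g_0\in N_G(P,\tilde e)$ be any element such that $g_0N_G(P,e)$ generates $N_G(P,\tilde e)/N_G(P,e)$, and let $\sigma=c_{g_0}\in\mathrm{Aut}(P)$. Then $$\tilde{\mathcal F}=\langle\mathcal F,\sigma\rangle .$$ More precisely, $\sigma\in\mathrm{Aut}_{\tilde{\mathcal F}}(P)$, and for all subgroups $Q,R\le P$ and every $\varphi\in\mathrm{Hom}_{\tilde{\mathcal F}}(Q,R)$ there exist $i\in\mathbb Z$, $\psi\in\mathrm{Hom}_{\mathcal F}(Q,\sigma^{-i}(R))$ and $\psi'\in\mathrm{Hom}_{\mathcal F}(\sigma^i(Q),R)$ such that $$\varphi=\sigma^i|_{\sigma^{-i}(R)}\circ\psi=\psi'\circ\sigma^i|_Q .$$ -/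

import Mathlib

open scoped MonoidAlgebra

namespace BlockFusion

noncomputable section

/-! ### Group algebras, primitive idempotents and blocks -/

section GroupAlgebra

variable (k : Type*) [Field k] {G : Type*} [Group G]

/-- The group algebra `kH` of a subgroup `H ≤ G`, regarded as a subalgebra of `kG`. -/
def subgroupAlgebra (H : Subgroup G) : Subalgebra k k[G] :=
  (MonoidAlgebra.mapDomainAlgHom k k H.subtype).range

/-- The centre `Z(kH)`, regarded as a subalgebra of `kG`: the elements of `kH` which commute
with all elements of `kH`. -/
def centerSubgroupAlgebra (H : Subgroup G) : Subalgebra k k[G] :=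
  subgroupAlgebra k H ⊓ Subalgebra.centralizer k (subgroupAlgebra k H : Set k[G])

/-- The `k`-linear extension `c_x : kG → kG` of the conjugation map `g ↦ x g x⁻¹`. -/
def conj (x : G) : k[G] ≃ₐ[k] k[G] :=
  MonoidAlgebra.domCongr k k (MulAut.conj x)

/-- The subalgebra `(kG)^P` of fixed points of `P` acting by conjugation on `kG`. -/
def fixedSubalgebra (P : Subgroup G) : Subalgebra k k[G] where
  carrier := {a | ∀ x ∈ P, conj k x a = a}
  mul_mem' ha hb x hx := by rw [map_mul, ha x hx, hb x hx]
  add_mem' ha hb x hx := by rw [map_add, ha x hx, hb x hx]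
  algebraMap_mem' r x _ := AlgEquiv.commutes (conj k x) r

open scoped Classical in
/-- The Brauer map `Br_P`: the `k`-linear projection which keeps the coefficients at the elements
of `C_G(P)` and deletes all the others. The Brauer homomorphism is its restriction to `(kG)^P`. -/
def brauerMap (P : Subgroup G) (a : k[G]) : k[G] :=
  MonoidAlgebra.ofCoeff (a.coeff.filter (fun g => g ∈ Subgroup.centralizer (P : Set G)))

variable {k}

/-- `i` is a primitive idempotent of the subalgebra `S`: a non-zero idempotent of `S` which is not
the sum of two orthogonal non-zero idempotents of `S`. -/
structure IsPrimitiveIdempotent {A : Type*} [Ring A] [Algebra k A] (S : Subalgebra k A) (i : A) :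
    Prop where
  mem : i ∈ S
  idem : i * i = i
  ne_zero : i ≠ 0
  indecomposable : ∀ j ∈ S, ∀ l ∈ S, j * j = j → l * l = l → j * l = 0 → l * j = 0 →
    j + l = i → j = 0 ∨ l = 0

/-- `b` is a block idempotent of `kH`, i.e. a primitive idempotent of `Z(kH)`. -/
def IsBlockIdempotent (H : Subgroup G) (b : k[G]) : Prop :=
  IsPrimitiveIdempotent (centerSubgroupAlgebra k H) b

/-! ### Brauer pairs -/

/-- `x = (P, e)` is a `kG`-Brauer pair: `P` is a `p`-subgroup of `G` and `e` is a block idempotent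
of `kC_G(P)`. -/
def IsBrauerPair (p : ℕ) (x : Subgroup G × k[G]) : Prop :=
  IsPGroup p x.1 ∧ IsBlockIdempotent (Subgroup.centralizer (x.1 : Set G)) x.2

/-- `x = (P, e)` is a `(kG, b)`-Brauer pair: a `kG`-Brauer pair with `Br_P(b) e = e`. -/
def IsBlockBrauerPair (p : ℕ) (b : k[G]) (x : Subgroup G × k[G]) : Prop :=
  IsBrauerPair p x ∧ brauerMap k x.1 b * x.2 = x.2

/-- `i` is associated to `x = (P, e)`: `e Br_P(i) = Br_P(i) ≠ 0`. -/
def IsAssociated (i : k[G]) (x : Subgroup G × k[G]) : Prop :=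
  x.2 * brauerMap k x.1 i = brauerMap k x.1 i ∧ brauerMap k x.1 i ≠ 0

/-- The relation `(Q, f) ≤ (P, e)` between Brauer pairs: `Q ≤ P`, and every primitive idempotent
of `(kG)^P` which is associated to `(P, e)` is also associated to `(Q, f)`. -/
def BrauerLE (x y : Subgroup G × k[G]) : Prop :=
  x.1 ≤ y.1 ∧ ∀ i : k[G], IsPrimitiveIdempotent (fixedSubalgebra k y.1) i →
    IsAssociated i y → IsAssociated i x

/-- `x` is a maximal element of the poset of `(kG, b)`-Brauer pairs. -/
def IsMaximalBrauerPair (p : ℕ) (b : k[G]) (x : Subgroup G × k[G]) : Prop :=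
  IsBlockBrauerPair p b x ∧ ∀ y, IsBlockBrauerPair p b y → BrauerLE x y → y = x

/-- The conjugate `ˣ(P, e) = (xPx⁻¹, c_x(e))`. -/
def conjPair (x : G) (y : Subgroup G × k[G]) : Subgroup G × k[G] :=
  (y.1.map (MulAut.conj x).toMonoidHom, conj k x y.2)

theorem conjPair_one (y : Subgroup G × k[G]) : conjPair 1 y = y := by
  refine Prod.ext ?_ ?_
  · ext g; simp [conjPair]
  · ext g
    simp only [conjPair, conj, map_one, MonoidAlgebra.coeff_domCongr]
    rfl

theorem conjPair_mul (x x' : G) (y : Subgroup G × k[G]) :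
    conjPair (x * x') y = conjPair x (conjPair x' y) := by
  refine Prod.ext ?_ ?_
  · simp only [conjPair, Subgroup.map_map]
    congr 1
    ext g; simp
  · ext g
    simp only [conjPair, conj, map_mul, MonoidAlgebra.coeff_domCongr]
    rfl

/-- The stabilizer `N_G(P, e)` in `G` of a pair `(P, e)`. -/
def pairNormalizer (y : Subgroup G × k[G]) : Subgroup G where
  carrier := {x | conjPair x y = y}
  one_mem' := conjPair_one y
  mul_mem' {a b} ha hb := by
    change conjPair (a * b) y = y
    rw [conjPair_mul, show conjPair b y = y from hb, show conjPair a y = y from ha]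
  inv_mem' {a} ha := by
    change conjPair a⁻¹ y = y
    conv_lhs => rw [← show conjPair a y = y from ha]
    rw [← conjPair_mul, inv_mul_cancel, conjPair_one]

theorem pairNormalizer_le (y : Subgroup G × k[G]) :
    pairNormalizer y ≤ Subgroup.normalizer (y.1 : Set G) := by
  intro x hx
  have h : y.1.map (MulAut.conj x).toMonoidHom = y.1 := congrArg Prod.fst hx
  rw [Subgroup.mem_normalizer_iff]
  intro u
  constructor
  · intro hu
    rw [← h]
    exact ⟨u, hu, rfl⟩
  · intro hu
    rw [← h] at hu
    obtain ⟨v, hv, hvu⟩ := hu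
    have : v = u := by simpa using hvu
    exact this ▸ hv

/-- The automorphism `c_g` of `P` for `g ∈ N_G(P, e)`. -/
def conjAut (y : Subgroup G × k[G]) : pairNormalizer y →* MulAut y.1 :=
  y.1.normalizerMonoidHom.comp (Subgroup.inclusion (pairNormalizer_le y))

theorem conjAut_apply (y : Subgroup G × k[G]) (g : pairNormalizer y) (u : y.1) :
    (conjAut y g u : G) = g * u * (g : G)⁻¹ := rfl

end GroupAlgebra

/-! ### Galois action on group algebras -/

section Galois

variable (K : Type*) {L G : Type*} [Field K] [Field L] [Algebra K L] [Group G]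

/-- The action of `γ ∈ Gal(L/K)` on `LG` through the coefficients. -/
def galoisAct {K : Type*} [Field K] [Algebra K L] (γ : L ≃ₐ[K] L) : L[G] →+* L[G] :=
  MonoidAlgebra.mapRingHom G (γ : L →+* L)

/-- The inclusion `KG ⊆ LG`. -/
def scalarExt (K L G : Type*) [Field K] [Field L] [Algebra K L] [Group G] : K[G] →+* L[G] :=
  MonoidAlgebra.mapRingHom G (algebraMap K L)

variable [FiniteDimensional K L]

open scoped Classical in
/-- The sum in `LG` of the distinct conjugates of `b` under `Gal(L/K)`. -/
def conjugateSum (b : L[G]) : L[G] :=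
  ∑ c ∈ Finset.univ.image (fun γ : L ≃ₐ[K] L => galoisAct γ b), c

theorem galoisAct_conjugateSum (b : L[G]) (δ : L ≃ₐ[K] L) :
    galoisAct δ (conjugateSum K b) = conjugateSum K b := by
  classical
  have hmul : ∀ (γ γ' : L ≃ₐ[K] L) (a : L[G]),
      galoisAct γ (galoisAct γ' a) = galoisAct (γ * γ') a := by
    intro γ γ' a
    ext g
    simp [galoisAct]
  have hinj : Function.Injective (galoisAct (G := G) δ) := by
    intro a a' h
    have h' := congrArg (galoisAct δ⁻¹) h
    rw [hmul, hmul, inv_mul_cancel] at h'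
    have hone : ∀ a : L[G], galoisAct (1 : L ≃ₐ[K] L) a = a := by
      intro a; ext g; simp [galoisAct]
    rwa [hone, hone] at h'
  unfold conjugateSum
  rw [map_sum, ← Finset.sum_image (f := fun c => c) (fun a _ a' _ h => hinj h), Finset.image_image]
  congr 1
  ext c
  simp only [Finset.mem_image, Finset.mem_univ, true_and, Function.comp, hmul]
  constructor
  · rintro ⟨γ, rfl⟩
    exact ⟨δ * γ, rfl⟩
  · rintro ⟨γ, rfl⟩
    exact ⟨δ⁻¹ * γ, by rw [mul_inv_cancel_left]⟩

theorem exists_scalarExt_eq [IsGalois K L] (b : L[G]) :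
    ∃ c : K[G], scalarExt K L G c = conjugateSum K b := by
  have h : ∀ g : G, ∃ r : K, algebraMap K L r = (conjugateSum K b).coeff g := by
    intro g
    refine (IsGalois.mem_range_algebraMap_iff_fixed _).mpr fun δ => ?_
    conv_rhs => rw [← galoisAct_conjugateSum K b δ]
    simp [galoisAct]
  choose r hr using h
  refine ⟨MonoidAlgebra.ofCoeff (Finsupp.onFinset (conjugateSum K b).coeff.support r ?_), ?_⟩
  · intro g hg
    rw [Finsupp.mem_support_iff, ← hr g]
    exact fun h0 => hg ((map_eq_zero _).mp h0)
  · ext g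
    simp [scalarExt, hr]

/-- The element `b̃` of `KG` associated to `b ∈ LG`: the sum of the distinct `Gal(L/K)`-conjugates
of `b`, whose coefficients lie in `K`. -/
def tilde [IsGalois K L] (b : L[G]) : K[G] :=
  (exists_scalarExt_eq K b).choose

theorem scalarExt_tilde [IsGalois K L] (b : L[G]) :
    scalarExt K L G (tilde K b) = conjugateSum K b :=
  (exists_scalarExt_eq K b).choose_spec

end Galois

/-! ### Fusion systems -/

section Fusion

variable {P : Type*} [Group P]

/-- A family of sets of group homomorphisms `Hom(Q, R)`, for all subgroups `Q` and `R` of `P`. -/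
abbrev HomFamily (P : Type*) [Group P] : Type _ :=
  (Q R : Subgroup P) → Set (Q →* R)

/-- The image `φ(Q)` of `φ : Q → R`, as a subgroup of `P`. -/
def image {Q R : Subgroup P} (φ : Q →* R) : Subgroup P :=
  (R.subtype.comp φ).range

/-- The homomorphism `Q → φ(Q)`, `u ↦ φ(u)`. -/
def toImage {Q R : Subgroup P} (φ : Q →* R) : Q →* image φ :=
  (R.subtype.comp φ).rangeRestrict

/-- The family `F` is a fusion system over `P`: its members are the morphisms of a subcategory of
the category of groups whose objects are the subgroups of `P`; they are injective, they include all
homomorphisms which are induced by conjugation with elements of `P`, and for each of them, the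
isomorphism onto its image and the inverse of this isomorphism belong to `F`. -/
structure IsFusionSystem (F : HomFamily P) : Prop where
  id_mem : ∀ Q : Subgroup P, MonoidHom.id Q ∈ F Q Q
  comp_mem : ∀ {Q R S : Subgroup P} (φ : Q →* R) (ψ : R →* S),
    φ ∈ F Q R → ψ ∈ F R S → ψ.comp φ ∈ F Q S
  conj_mem : ∀ {Q R : Subgroup P} (φ : Q →* R),
    (∃ x : P, ∀ u : Q, (φ u : P) = x * u * x⁻¹) → φ ∈ F Q R
  injective : ∀ {Q R : Subgroup P} (φ : Q →* R), φ ∈ F Q R → Function.Injective φ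
  toImage_mem : ∀ {Q R : Subgroup P} (φ : Q →* R), φ ∈ F Q R → toImage φ ∈ F Q (image φ)
  inv_mem : ∀ {Q R : Subgroup P} (φ : Q →* R), φ ∈ F Q R →
    ∃ θ ∈ F (image φ) Q, ∀ u : Q, θ (toImage φ u) = u

/-- The restriction `Q → R` of an automorphism `σ` of `P` with `σ(Q) ≤ R`. -/
def restrictAut (σ : MulAut P) (Q R : Subgroup P) (h : Q.map σ.toMonoidHom ≤ R) : Q →* R :=
  (σ.toMonoidHom.comp Q.subtype).codRestrict R fun u => h ⟨u, u.2, rfl⟩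

/-- The automorphism `σ` of `P` belongs to `Hom_F(P, P)`. -/
def MemAut (F : HomFamily P) (σ : MulAut P) : Prop :=
  restrictAut σ ⊤ ⊤ le_top ∈ F ⊤ ⊤

/-- The fusion system `⟨F, σ⟩`: the intersection of all fusion systems over `P` which contain `F`
and `σ`. -/
def generated (F : HomFamily P) (σ : MulAut P) : HomFamily P := fun Q R =>
  {φ | ∀ E : HomFamily P, IsFusionSystem E → (∀ Q' R', F Q' R' ⊆ E Q' R') → MemAut E σ →
    φ ∈ E Q R}

theorem map_zpow_neg_le (σ : MulAut P) (i : ℤ) (R : Subgroup P) :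
    (R.map (σ ^ (-i)).toMonoidHom).map (σ ^ i).toMonoidHom ≤ R := by
  rintro _ ⟨_, ⟨u, hu, rfl⟩, rfl⟩
  have h : (σ ^ i) ((σ ^ (-i)) u) = u := by
    rw [← MulAut.mul_apply, ← zpow_add, add_neg_cancel, zpow_zero, MulAut.one_apply]
  change (σ ^ i) ((σ ^ (-i)) u) ∈ R
  rw [h]
  exact hu

end Fusion

/-- The fusion system `F_{(P,e)}(kGb)` for `x = (P, e)` a maximal `(kG, b)`-Brauer pair. The
morphisms `Q → R` are the group homomorphisms `φ` for which there is `g ∈ G` with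
`φ(u) = g u g⁻¹` for all `u ∈ Q` and `ᵍ(Q, e_Q) ≤ (R, e_R)`, where `e_Q` is the unique block
idempotent of `kC_G(Q)` such that `(Q, e_Q) ≤ (P, e)`, and similarly for `e_R`. (The idempotent `b`
is determined by `(P, e)` and does not occur in the definition of the morphisms.) -/
def blockFusion {k G : Type*} [Field k] [Group G] (p : ℕ) (x : Subgroup G × k[G]) :
    HomFamily x.1 := fun Q R =>
  {φ | ∃ (g : G) (eQ eR : k[G]),
    (IsBrauerPair p (Q.map x.1.subtype, eQ) ∧ BrauerLE (Q.map x.1.subtype, eQ) x) ∧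
    (IsBrauerPair p (R.map x.1.subtype, eR) ∧ BrauerLE (R.map x.1.subtype, eR) x) ∧
    (∀ u : Q, ((φ u : x.1) : G) = g * ((u : x.1) : G) * g⁻¹) ∧
    BrauerLE (conjPair g (Q.map x.1.subtype, eQ)) (R.map x.1.subtype, eR)}

end

end BlockFusion

/-! The blocks of `KH` are the Galois orbit sums of blocks of `LH`: a central idempotent with
coefficients in `K` kills or fixes a block `b` of `LH`, and then it does the same to all Galois
conjugates of `b` (`IsBlockIdempotent.tilde`, `IsBlockIdempotent.exists_galoisAct_eq`). Passing to
orbit sums preserves inclusion of Brauer pairs (`BrauerLE.tildePair`) and maximality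
(`IsMaximalBrauerPair.tildePair`), and it commutes with conjugation by `G`.

Two classical facts are needed over an arbitrary field of characteristic `p` and are proved here.
One is the Alperin–Broué theorem that below `(P, e)` there is exactly one pair for each `Q ≤ P`
(`IsBrauerPair.exists_brauerLE`, `IsBrauerPair.brauerLE_unique`). The other is that every pair of a
block lies in a conjugate of any given maximal pair
(`IsMaximalBrauerPair.exists_brauerLE_conjPair`), which comes from writing the block as a relative
trace.

Cyclic quotient: an element `g` of `N_G(P, ẽ)` moves `e` to a Galois conjugate. The coefficients of
`e` lie in a finite field, since the coefficientwise Frobenius permutes the finitely many central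
idempotents. Hence `c_g(e)` is a Frobenius power of `e`, and the exponent modulo the period of `e`
is a homomorphism with kernel `N_G(P, e)` (`exists_hom_ker_eq`).

Fusion: let `g` induce a morphism `Q → R` of the fusion system over `K`. Over `L` the inclusion only
holds up to Galois conjugation: `ᵍγ(Q, e_Q) ≤ (R, e_R)` for some `γ`. Thus `γ(P, e)` belongs to the
same block `b`, so it equals `ʰ(P, e)` with `h` in `N_G(P, ẽ)` (`exists_galoisPair_brauerLE`).
Replacing `h` by a power of `g₀` and absorbing it on either side of the morphism gives the two
factorisations (`exists_comp_restrictAut`), and the equality with the generated fusion system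
follows. -/

namespace BlockFusion

/-! ### Primitive idempotents in subalgebras of finite-dimensional algebras. -/

section Idempotents

variable {k A : Type*} [Field k] [Ring A] [Algebra k A]

/-- Fitting's lemma inside `k[c]`: the idempotent `w * c` projects onto the part where `c` is
invertible, and `c` is nilpotent on the complement. -/
theorem exists_fitting_idempotent [FiniteDimensional k A] (S : Subalgebra k A) {c : A}
    (hc : c ∈ S) :
    ∃ w ∈ S, ∃ n : ℕ, w * c = c * w ∧ (w * c) * (w * c) = w * c ∧ c ^ n = c ^ n * (w * c) := by
  have hint : IsIntegral k c := Algebra.IsIntegral.isIntegral c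
  have hm0 : minpoly k c ≠ 0 := minpoly.ne_zero hint
  obtain ⟨r, hr, hnd⟩ := Polynomial.exists_eq_pow_rootMultiplicity_mul_and_not_dvd
    (minpoly k c) hm0 0
  set n := Polynomial.rootMultiplicity 0 (minpoly k c)
  rw [Polynomial.C_0, sub_zero] at hr hnd
  -- The exponent `n + 1` instead of `n` leaves a factor `X` to split off the Bézout term, even when
  -- `n = 0`.
  have hcop : IsCoprime ((Polynomial.X : Polynomial k) ^ (n + 1)) r :=
    ((Polynomial.irreducible_X (R := k)).coprime_iff_not_dvd.mpr hnd).pow_left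
  obtain ⟨u, v, huv⟩ := hcop
  have hzero : Polynomial.aeval c (Polynomial.X ^ n * r) = 0 := by
    rw [← hr]; exact minpoly.aeval k c
  have hwc : Polynomial.aeval c (u * Polynomial.X ^ n) * c =
      Polynomial.aeval c (u * Polynomial.X ^ (n + 1)) := by
    rw [pow_succ, ← mul_assoc, map_mul _ (u * Polynomial.X ^ n), Polynomial.aeval_X]
  have hone : 1 - Polynomial.aeval c (u * Polynomial.X ^ (n + 1)) = Polynomial.aeval c (v * r) := by
    rw [sub_eq_iff_eq_add, add_comm, ← map_add, huv, map_one]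
  refine ⟨Polynomial.aeval c (u * Polynomial.X ^ n), ?_, n, ?_, ?_, ?_⟩
  · exact Algebra.adjoin_le (Set.singleton_subset_iff.mpr hc) (Polynomial.aeval_mem_adjoin_singleton k c)
  · rw [hwc]
    have : c * Polynomial.aeval c (u * Polynomial.X ^ n) =
        Polynomial.aeval c (Polynomial.X * (u * Polynomial.X ^ n)) := by
      rw [map_mul _ Polynomial.X, Polynomial.aeval_X]
    rw [this]
    exact congrArg _ (by ring)
  · rw [hwc, ← sub_eq_zero, ← neg_eq_zero, neg_sub, ← mul_one_sub, hone, ← map_mul]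
    have : u * Polynomial.X ^ (n + 1) * (v * r) =
        (u * v * Polynomial.X) * (Polynomial.X ^ n * r) := by ring
    rw [this, map_mul, hzero, mul_zero]
  · rw [hwc, ← sub_eq_zero, ← mul_one_sub, hone]
    have hcn : c ^ n = Polynomial.aeval c (Polynomial.X ^ n : Polynomial k) := by simp
    rw [hcn, ← map_mul]
    have : Polynomial.X ^ n * (v * r) = v * (Polynomial.X ^ n * r) := by ring
    rw [this, map_mul, hzero, mul_zero]

variable {S : Subalgebra k A} {i : A}

theorem IsPrimitiveIdempotent.eq_zero_or_eq (hi : IsPrimitiveIdempotent S i) {z : A}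
    (hz : z ∈ S) (hzz : z * z = z) (h1 : i * z = z) (h2 : z * i = z) : z = 0 ∨ z = i := by
  rcases hi.indecomposable z hz (i - z) (S.sub_mem hi.mem hz) hzz
    (by rw [mul_sub, sub_mul, sub_mul, hi.idem, h2, h1, hzz]; abel)
    (by rw [mul_sub, h2, hzz, sub_self])
    (by rw [sub_mul, h1, hzz, sub_self]) (by abel) with h | h
  · exact Or.inl h
  · exact Or.inr (sub_eq_zero.mp h).symm

/-- This is the locality of `iSi`. The Fitting idempotent of `c` lies below `i`, so it is `0` or
`i`. -/
theorem IsPrimitiveIdempotent.isNilpotent_or_exists_mul_eq [FiniteDimensional k A]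
    (hi : IsPrimitiveIdempotent S i) {c : A} (hc : c ∈ S) (h1 : i * c = c) (h2 : c * i = c) :
    IsNilpotent c ∨ ∃ w ∈ S, w * c = i := by
  obtain ⟨w, hw, n, hcomm, hidem, hpow⟩ := exists_fitting_idempotent S hc
  rcases hi.eq_zero_or_eq (S.mul_mem hw hc) hidem
    (by rw [hcomm, ← mul_assoc, h1]) (by rw [mul_assoc, h2]) with h | h
  · left
    exact ⟨n, by rw [hpow, h, mul_zero]⟩
  · exact Or.inr ⟨w, hw, h⟩

theorem IsPrimitiveIdempotent.mul_eq_zero_or_eq (hi : IsPrimitiveIdempotent S i) {z : A}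
    (hz : z ∈ S) (hzz : z * z = z) (hcomm : z * i = i * z) : z * i = 0 ∨ z * i = i := by
  refine hi.eq_zero_or_eq (S.mul_mem hz hi.mem) ?_ ?_ ?_
  · rw [mul_assoc, ← mul_assoc i, ← hcomm, mul_assoc z i i, hi.idem, ← mul_assoc, hzz]
  · rw [hcomm, ← mul_assoc, hi.idem]
  · rw [mul_assoc, hi.idem]

theorem IsPrimitiveIdempotent.mul_eq_zero_or_eq_of_comm (hcomm : ∀ a ∈ S, ∀ b ∈ S, a * b = b * a)
    (hi : IsPrimitiveIdempotent S i) {j : A} (hj : IsPrimitiveIdempotent S j) :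
    i * j = 0 ∨ i = j := by
  rcases hi.mul_eq_zero_or_eq hj.mem hj.idem (hcomm _ hj.mem _ hi.mem) with h | h
  · left; rw [hcomm _ hi.mem _ hj.mem, h]
  · rcases hj.mul_eq_zero_or_eq hi.mem hi.idem (hcomm _ hi.mem _ hj.mem) with h' | h'
    · exact Or.inl h'
    · right; rw [← h, hcomm _ hj.mem _ hi.mem, h']

theorem IsPrimitiveIdempotent.not_isNilpotent (hi : IsPrimitiveIdempotent S i) :
    ¬ IsNilpotent i := fun h => hi.ne_zero (IsIdempotentElem.eq_zero_of_isNilpotent hi.idem h)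

/-- A commutative form of Rosenberg's lemma: if no summand became invertible under `i`, then `i`
would be a sum of commuting nilpotent elements. -/
theorem IsPrimitiveIdempotent.exists_mul_eq_of_sum_eq [FiniteDimensional k A]
    (hcomm : ∀ a ∈ S, ∀ b ∈ S, a * b = b * a) (hi : IsPrimitiveIdempotent S i) {ι : Type*}
    (s : Finset ι) (z : ι → A) (hz : ∀ l ∈ s, z l ∈ S) (hsum : ∑ l ∈ s, z l = i) :
    ∃ l ∈ s, ∃ w ∈ S, z l * w = i := by
  by_contra hcon
  push Not at hcon
  apply hi.not_isNilpotent
  have hsum' : ∑ l ∈ s, i * z l * i = i := by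
    rw [← Finset.sum_mul, ← Finset.mul_sum, hsum, hi.idem, hi.idem]
  rw [← hsum']
  have hmem : ∀ l ∈ s, i * z l * i ∈ S := fun l hl => mul_mem (mul_mem hi.mem (hz l hl)) hi.mem
  refine Commute.isNilpotent_sum (fun l hl => ?_)
    fun l m hl hm => hcomm _ (hmem l hl) _ (hmem m hm)
  refine (hi.isNilpotent_or_exists_mul_eq (hmem l hl) (by rw [← mul_assoc, ← mul_assoc, hi.idem])
    (by rw [mul_assoc, hi.idem])).resolve_right ?_
  rintro ⟨w, hw, hwi⟩
  refine hcon l hl (i * (w * i)) (mul_mem hi.mem (mul_mem hw hi.mem)) ?_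
  conv_rhs => rw [← hwi]
  rw [hcomm w hw _ (hmem l hl), ← mul_assoc, ← mul_assoc, hcomm _ (hz l hl) _ hi.mem,
    mul_assoc _ w i, hcomm w hw i hi.mem, ← mul_assoc]

/-- `T` stands for a property such as "not killed by an additive map". In a proper splitting of `i`
it passes to one of the summands `j`, and the right ideal `jA` is strictly smaller than `iA`, so the
descent stops at a primitive idempotent. -/
theorem exists_isPrimitiveIdempotent [FiniteDimensional k A] (T : A → Prop) (h0 : ¬ T 0)
    (hT : ∀ x ∈ S, ∀ y ∈ S, T (x + y) → T x ∨ T y) (hiS : i ∈ S) (hii : i * i = i) (hTi : T i) :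
    ∃ j, IsPrimitiveIdempotent S j ∧ i * j = j ∧ j * i = j ∧ T j := by
  induction hn : Module.finrank k (LinearMap.mulLeft k i).range using Nat.strong_induction_on
    generalizing i with
  | _ n ih =>
  by_cases hprim : IsPrimitiveIdempotent S i
  · exact ⟨i, hprim, hii, hii, hTi⟩
  · have hi0 : i ≠ 0 := fun h => h0 (h ▸ hTi)
    have : ∃ j ∈ S, ∃ l ∈ S, j * j = j ∧ l * l = l ∧ j * l = 0 ∧ l * j = 0 ∧
        j + l = i ∧ j ≠ 0 ∧ l ≠ 0 := by
      by_contra hcon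
      push Not at hcon
      refine hprim ⟨hiS, hii, hi0, fun j hj l hl h1 h2 h3 h4 h5 => ?_⟩
      by_contra h6
      push Not at h6
      exact h6.2 (hcon j hj l hl h1 h2 h3 h4 h5 h6.1)
    obtain ⟨j, hj, l, hl, hjj, hll, hjl, hlj, hsum, hj0, hl0⟩ := this
    have key : ∀ j l : A, j ∈ S → j * j = j → j * l = 0 → l * j = 0 → l * l = l → j + l = i →
        l ≠ 0 → T j → ∃ j, IsPrimitiveIdempotent S j ∧ i * j = j ∧ j * i = j ∧ T j := by
      intro j l hj hjj hjl hlj hll hsum hl0 hTj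
      have hij : i * j = j := by rw [← hsum, add_mul, hjj, hlj, add_zero]
      have hji : j * i = j := by rw [← hsum, mul_add, hjj, hjl, add_zero]
      have hlt : (LinearMap.mulLeft k j).range < (LinearMap.mulLeft k i).range := by
        refine lt_of_le_not_ge ?_ ?_
        · rintro _ ⟨x, rfl⟩
          exact ⟨j * x, by simp [← mul_assoc, hij]⟩
        · intro hle
          have : l ∈ (LinearMap.mulLeft k i).range :=
            ⟨l, by simp [← hsum, add_mul, hjl, hll]⟩
          obtain ⟨x, hx⟩ := hle this
          rw [LinearMap.mulLeft_apply] at hx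
          apply hl0
          rw [← hjl, ← hx, ← mul_assoc, hjj]
      obtain ⟨j', hj', h1, h2, h3⟩ := ih _ (hn ▸ Submodule.finrank_lt_finrank_of_lt hlt) hj hjj
        hTj rfl
      exact ⟨j', hj', by rw [← h1, ← mul_assoc, hij], by rw [← h2, mul_assoc, hji], h3⟩
    rcases hT j hj l hl (hsum ▸ hTi) with h | h
    · exact key j l hj hjj hjl hlj hll hsum hl0 h
    · exact key l j hl hll hlj hjl hjj (by rw [add_comm, hsum]) hj0 h

/-- In a commutative subalgebra distinct primitive idempotents are orthogonal, hence linearly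
independent. -/
theorem finite_isPrimitiveIdempotent [FiniteDimensional k A]
    (hcomm : ∀ a ∈ S, ∀ b ∈ S, a * b = b * a) : {i | IsPrimitiveIdempotent S i}.Finite := by
  have : LinearIndependent k (fun i : {i | IsPrimitiveIdempotent S i} => (i : A)) := by
    classical
    rw [linearIndependent_iff']
    intro s g hg i hi
    have h := congrArg (fun x => (i : A) * x) hg
    simp only [Finset.mul_sum, mul_zero, mul_smul_comm] at h
    rw [Finset.sum_eq_single i] at h
    · rw [i.2.idem] at h
      exact (smul_eq_zero.mp h).resolve_right i.2.ne_zero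
    · intro j _ hji
      rcases i.2.mul_eq_zero_or_eq_of_comm hcomm j.2 with h' | h'
      · rw [h', smul_zero]
      · exact absurd (Subtype.ext h').symm hji
    · exact fun h' => absurd hi h'
  exact this.setFinite

theorem sum_isPrimitiveIdempotent [FiniteDimensional k A]
    (hcomm : ∀ a ∈ S, ∀ b ∈ S, a * b = b * a) (B : Finset A)
    (hB : ∀ i, i ∈ B ↔ IsPrimitiveIdempotent S i) : ∑ i ∈ B, i = 1 := by
  classical
  have hmul : ∀ i ∈ B, i * ∑ j ∈ B, j = i := by
    intro i hi
    rw [Finset.mul_sum, Finset.sum_eq_single i]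
    · exact ((hB i).mp hi).idem
    · intro j hj hji
      exact (((hB i).mp hi).mul_eq_zero_or_eq_of_comm hcomm ((hB j).mp hj)).resolve_right
        (Ne.symm hji)
    · exact fun h => absurd hi h
  have hS : ∑ j ∈ B, j ∈ S := S.sum_mem fun j hj => ((hB j).mp hj).mem
  by_contra hne
  have hidem : (∑ j ∈ B, j) * (∑ j ∈ B, j) = ∑ j ∈ B, j := by
    conv_lhs => rw [Finset.sum_mul]
    exact Finset.sum_congr rfl hmul
  obtain ⟨j, hj, h1, h2, -⟩ := exists_isPrimitiveIdempotent (S := S) (i := 1 - ∑ j ∈ B, j)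
    (fun x => x ≠ 0) (by simp)
    (fun x _ y _ h => by
      by_contra h'
      push Not at h'
      exact h (by rw [h'.1, h'.2, add_zero]))
    (S.sub_mem S.one_mem hS) (by rw [mul_one_sub, sub_mul, one_mul, hidem, sub_self, sub_zero])
    (sub_ne_zero.mpr (Ne.symm hne))
  rw [mul_sub, mul_one, hmul j ((hB j).mpr hj), sub_self] at h2
  exact hj.ne_zero h2.symm

/-- An idempotent is the sum of the primitive idempotents that it fixes, so it is determined by a
subset of a finite set. -/
theorem finite_idempotents [FiniteDimensional k A]
    (hcomm : ∀ a ∈ S, ∀ b ∈ S, a * b = b * a) : {z | z ∈ S ∧ z * z = z}.Finite := by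
  classical
  have hfin := finite_isPrimitiveIdempotent hcomm
  have hone := sum_isPrimitiveIdempotent hcomm hfin.toFinset (by simp)
  refine Set.Finite.of_finite_image (f := fun z => {i ∈ hfin.toFinset | z * i = i})
    (Set.Finite.subset (Finset.finite_toSet (hfin.toFinset.powerset)) ?_) ?_
  · rintro _ ⟨z, -, rfl⟩
    exact Finset.mem_coe.mpr (Finset.mem_powerset.mpr (Finset.filter_subset _ _))
  · have key : ∀ z ∈ {z | z ∈ S ∧ z * z = z}, z = ∑ i ∈ hfin.toFinset with z * i = i, i := by
      rintro z ⟨hz, hzz⟩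
      conv_lhs => rw [← mul_one z, ← hone, Finset.mul_sum]
      rw [Finset.sum_filter]
      refine Finset.sum_congr rfl fun i hi => ?_
      have hi' : IsPrimitiveIdempotent S i := by simpa using hi
      rcases hi'.mul_eq_zero_or_eq hz hzz (hcomm _ hz _ hi'.mem) with h | h
      · rw [h, if_neg (Ne.symm hi'.ne_zero)]
      · rw [if_pos h, h]
    intro z hz z' hz' h
    rw [key z hz, key z' hz']
    exact congrArg (fun s : Finset A => ∑ i ∈ s, i) h

/-- Only a ring isomorphism is required, because Galois automorphisms act on `LG` semilinearly. -/
theorem IsPrimitiveIdempotent.map {k' A' : Type*} [Field k'] [Ring A'] [Algebra k' A']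
    {S' : Subalgebra k' A'} (Θ : A ≃+* A') (hΘ : ∀ a, Θ a ∈ S' ↔ a ∈ S)
    (hi : IsPrimitiveIdempotent S i) : IsPrimitiveIdempotent S' (Θ i) := by
  refine ⟨(hΘ i).mpr hi.mem, by rw [← map_mul, hi.idem], by simpa using hi.ne_zero, ?_⟩
  intro j hj l hl hjj hll hjl hlj hsum
  obtain ⟨j, rfl⟩ := Θ.surjective j
  obtain ⟨l, rfl⟩ := Θ.surjective l
  rw [← map_mul, EmbeddingLike.apply_eq_iff_eq] at hjj hll
  rw [← map_mul, EmbeddingLike.map_eq_zero_iff] at hjl hlj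
  rw [← map_add, EmbeddingLike.apply_eq_iff_eq] at hsum
  rw [EmbeddingLike.map_eq_zero_iff, EmbeddingLike.map_eq_zero_iff]
  exact hi.indecomposable j ((hΘ j).mp hj) l ((hΘ l).mp hl) hjj hll hjl hlj hsum

end Idempotents

open scoped Classical in
/-- In characteristic `p`, the sum of an invariant function over a finite set on which a `p`-group
acts is the sum over the fixed points. -/
theorem sum_eq_sum_fixedPoints {p : ℕ} [Fact p.Prime] {k : Type*} [Field k] [CharP k p]
    {H X : Type*} [Group H] (hH : IsPGroup p H) [MulAction H X] [Fintype X] (F : X → k)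
    (hF : ∀ (h : H) (x : X), F (h • x) = F x) :
    ∑ x, F x = ∑ x with x ∈ MulAction.fixedPoints H X, F x := by
  -- Both sums are grouped by the value of `F`. Each fibre is stable under the group, so its
  -- cardinality is congruent modulo `p` to the number of its fixed points.
  rw [← Finset.sum_fiberwise_of_maps_to (t := Finset.univ.image F) (g := F) (by simp),
    ← Finset.sum_fiberwise_of_maps_to (s := Finset.univ.filter _) (t := Finset.univ.image F)
      (g := F) (by simp)]
  refine Finset.sum_congr rfl fun v _ => ?_
  rw [Finset.sum_congr rfl (g := fun _ => v) (by simp),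
    Finset.sum_congr (s₁ := Finset.filter _ (Finset.filter _ _)) rfl (g := fun _ => v) (by simp)]
  rw [Finset.sum_const, Finset.sum_const]
  let Y : SubMulAction H X := ⟨{x | F x = v}, fun h x hx => by
    simpa [hF] using hx⟩
  have hcard := hH.card_modEq_card_fixedPoints Y
  have h1 : Nat.card Y = (Finset.univ.filter fun x => F x = v).card := by
    rw [Nat.card_eq_fintype_card]
    exact Fintype.card_of_subtype _ (by intro x; rw [Finset.mem_filter]; simp only [Finset.mem_univ, true_and]; rfl)
  have h2 : Nat.card (MulAction.fixedPoints H Y) = ((Finset.univ.filter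
      fun x => x ∈ MulAction.fixedPoints H X).filter fun x => F x = v).card := by
    rw [Nat.card_eq_card_toFinset]
    refine Finset.card_bij (fun y _ => (y : X)) ?_ ?_ ?_
    · intro y hy
      have hy' : y ∈ MulAction.fixedPoints H Y := by simpa using hy
      simp only [Finset.mem_filter, Finset.mem_univ, true_and]
      exact ⟨fun h => congrArg Subtype.val (hy' h), y.2⟩
    · exact fun _ _ _ _ h => Subtype.ext h
    · intro x hx
      simp only [Finset.mem_filter, Finset.mem_univ, true_and] at hx
      refine ⟨⟨x, hx.2⟩, ?_, rfl⟩
      simp only [Set.mem_toFinset]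
      exact fun h => Subtype.ext (hx.1 h)
  rw [h1, h2] at hcard
  have := (CharP.natCast_eq_natCast' k p hcard)
  rw [nsmul_eq_mul, nsmul_eq_mul, this]

/-! ### Conjugation, fixed points and the Brauer map. -/

section GroupAlgebra

variable {k : Type*} [Field k] {G : Type*} [Group G]

theorem coeff_mul_eq_sum [Fintype G] (a b : k[G]) (g : G) :
    (a * b).coeff g = ∑ x, a.coeff x * b.coeff (x⁻¹ * g) := by
  rw [MonoidAlgebra.coeff_mul_apply_left, Finsupp.sum_fintype]
  simp

@[simp] theorem coeff_conj (x : G) (a : k[G]) (g : G) :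
    (conj k x a).coeff g = a.coeff (x⁻¹ * g * x) := by
  simp [conj]

theorem conj_one_apply (a : k[G]) : conj k 1 a = a := by
  ext g; simp

theorem conj_mul_apply (x y : G) (a : k[G]) : conj k (x * y) a = conj k x (conj k y a) := by
  ext g; simp [mul_assoc]

theorem conj_conj_inv (x : G) (a : k[G]) : conj k x (conj k x⁻¹ a) = a := by
  rw [← conj_mul_apply, mul_inv_cancel, conj_one_apply]

theorem conj_eq_mul (x : G) (a : k[G]) :
    conj k x a = MonoidAlgebra.single x 1 * a * MonoidAlgebra.single x⁻¹ 1 := by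
  ext g
  rw [MonoidAlgebra.coeff_mul_single_apply, MonoidAlgebra.coeff_single_mul_apply]
  simp [mul_assoc]

theorem conj_eq_self_iff (x : G) (a : k[G]) :
    conj k x a = a ↔ MonoidAlgebra.single x 1 * a = a * MonoidAlgebra.single x 1 := by
  have h1 : (MonoidAlgebra.single x⁻¹ 1 * MonoidAlgebra.single x 1 : k[G]) = 1 := by
    rw [MonoidAlgebra.single_mul_single, inv_mul_cancel, mul_one, MonoidAlgebra.one_def]
  have h2 : (MonoidAlgebra.single x 1 * MonoidAlgebra.single x⁻¹ 1 : k[G]) = 1 := by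
    rw [MonoidAlgebra.single_mul_single, mul_inv_cancel, mul_one, MonoidAlgebra.one_def]
  rw [conj_eq_mul]
  constructor
  · intro h
    conv_rhs => rw [← h, mul_assoc, h1, mul_one]
  · intro h
    rw [h, mul_assoc, h2, mul_one]

theorem mem_subgroupAlgebra_iff {H : Subgroup G} {a : k[G]} :
    a ∈ subgroupAlgebra k H ↔ ∀ g ∉ H, a.coeff g = 0 := by
  constructor
  · rintro ⟨c, rfl⟩ g hg
    change (MonoidAlgebra.mapDomain H.subtype c).coeff g = 0
    rw [MonoidAlgebra.coeff_mapDomain, Finsupp.mapDomain_of_notMem_range]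
    simpa using hg
  · intro h
    refine ⟨MonoidAlgebra.comapDomain H.subtype H.subtype_injective a, ?_⟩
    change MonoidAlgebra.mapDomain H.subtype _ = _
    refine MonoidAlgebra.mapDomain_comapDomain ?_ H.subtype_injective
    intro g hg
    by_contra hg'
    rw [Finset.mem_coe, Finsupp.mem_support_iff] at hg
    exact hg (h g (by simpa using hg'))

theorem single_mem_subgroupAlgebra {H : Subgroup G} {x : G} (hx : x ∈ H) :
    MonoidAlgebra.single x 1 ∈ subgroupAlgebra k H := by
  classical
  rw [mem_subgroupAlgebra_iff]
  intro g hg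
  rw [MonoidAlgebra.coeff_single, Finsupp.single_apply, if_neg]
  rintro rfl
  exact hg hx

theorem mem_centerSubgroupAlgebra_iff {H : Subgroup G} {a : k[G]} :
    a ∈ centerSubgroupAlgebra k H ↔ a ∈ subgroupAlgebra k H ∧ ∀ x ∈ H, conj k x a = a := by
  rw [centerSubgroupAlgebra, Algebra.mem_inf]
  refine and_congr_right fun ha => ?_
  rw [Subalgebra.mem_centralizer_iff]
  constructor
  · intro h x hx
    rw [conj_eq_self_iff]
    exact h _ (single_mem_subgroupAlgebra hx)
  · rintro h _ ⟨c, rfl⟩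
    induction c using MonoidAlgebra.induction_linear with
    | zero => simp
    | add x y hx hy => rw [map_add, add_mul, mul_add, hx, hy]
    | single x r =>
      have h1 := (conj_eq_self_iff (x : G) a).mp (h x x.2)
      have h2 : MonoidAlgebra.mapDomainAlgHom k k H.subtype (MonoidAlgebra.single x r) =
          r • (MonoidAlgebra.single (x : G) 1 : k[G]) := by
        simp
      change MonoidAlgebra.mapDomainAlgHom k k H.subtype (MonoidAlgebra.single x r) * a =
        a * MonoidAlgebra.mapDomainAlgHom k k H.subtype (MonoidAlgebra.single x r)
      rw [h2, smul_mul_assoc, mul_smul_comm, h1]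

theorem mul_comm_of_mem_center {H : Subgroup G} {a z : k[G]} (hz : z ∈ centerSubgroupAlgebra k H)
    (ha : a ∈ subgroupAlgebra k H) : a * z = z * a := by
  rw [centerSubgroupAlgebra, Algebra.mem_inf, Subalgebra.mem_centralizer_iff] at hz
  exact hz.2 a ha

theorem mem_subgroupAlgebra_of_mem_center {H : Subgroup G} {z : k[G]}
    (hz : z ∈ centerSubgroupAlgebra k H) : z ∈ subgroupAlgebra k H :=
  (mem_centerSubgroupAlgebra_iff.mp hz).1

theorem center_mul_comm (H : Subgroup G) :
    ∀ a ∈ centerSubgroupAlgebra k H, ∀ b ∈ centerSubgroupAlgebra k H, a * b = b * a :=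
  fun _ ha _ hb => mul_comm_of_mem_center hb (mem_subgroupAlgebra_of_mem_center ha)

theorem mem_fixedSubalgebra_iff {P : Subgroup G} {a : k[G]} :
    a ∈ fixedSubalgebra k P ↔ ∀ x ∈ P, conj k x a = a := Iff.rfl

theorem fixedSubalgebra_anti {P Q : Subgroup G} (h : Q ≤ P) :
    fixedSubalgebra k P ≤ fixedSubalgebra k Q := fun _ ha x hx => ha x (h hx)

theorem subgroupAlgebra_centralizer_le (P : Subgroup G) :
    subgroupAlgebra k (Subgroup.centralizer (P : Set G)) ≤ fixedSubalgebra k P := by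
  intro a ha x hx
  rw [mem_subgroupAlgebra_iff] at ha
  ext g
  rw [coeff_conj]
  by_cases hg : g ∈ Subgroup.centralizer (P : Set G)
  · have := Subgroup.mem_centralizer_iff.mp hg x hx
    rw [mul_assoc, ← this, inv_mul_cancel_left]
  · rw [ha g hg, ha]
    intro hg'
    apply hg
    have h := Subgroup.mem_centralizer_iff.mp hg' x hx
    have h2 : x⁻¹ * g * x = g := by
      have h3 : x * (x⁻¹ * g * x) * x⁻¹ = (x⁻¹ * g * x) := by rw [h, mul_inv_cancel_right]
      rw [← h3]; group
    rwa [h2] at hg'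

open scoped Classical in
theorem coeff_brauerMap (P : Subgroup G) (a : k[G]) (g : G) :
    (brauerMap k P a).coeff g =
      if g ∈ Subgroup.centralizer (P : Set G) then a.coeff g else 0 := by
  unfold brauerMap
  rw [MonoidAlgebra.coeff_ofCoeff, Finsupp.filter_apply]

theorem brauerMap_add (P : Subgroup G) (a b : k[G]) :
    brauerMap k P (a + b) = brauerMap k P a + brauerMap k P b := by
  classical
  ext g
  simp only [coeff_brauerMap, MonoidAlgebra.coeff_add, Finsupp.add_apply]
  split_ifs <;> simp

theorem brauerMap_zero (P : Subgroup G) : brauerMap k P 0 = 0 := by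
  classical
  ext g
  simp [coeff_brauerMap]

theorem brauerMap_sub (P : Subgroup G) (a b : k[G]) :
    brauerMap k P (a - b) = brauerMap k P a - brauerMap k P b := by
  rw [eq_sub_iff_add_eq, ← brauerMap_add, sub_add_cancel]

theorem brauerMap_sum (P : Subgroup G) {ι : Type*} (s : Finset ι) (f : ι → k[G]) :
    brauerMap k P (∑ i ∈ s, f i) = ∑ i ∈ s, brauerMap k P (f i) :=
  map_sum (⟨⟨brauerMap k P, brauerMap_zero P⟩, brauerMap_add P⟩ : k[G] →+ k[G]) f s

theorem brauerMap_mem (P : Subgroup G) (a : k[G]) :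
    brauerMap k P a ∈ subgroupAlgebra k (Subgroup.centralizer (P : Set G)) := by
  rw [mem_subgroupAlgebra_iff]
  intro g hg
  rw [coeff_brauerMap, if_neg hg]

theorem brauerMap_of_mem {P : Subgroup G} {a : k[G]}
    (ha : a ∈ subgroupAlgebra k (Subgroup.centralizer (P : Set G))) : brauerMap k P a = a := by
  classical
  ext g
  rw [coeff_brauerMap]
  split_ifs with h
  · rfl
  · exact (mem_subgroupAlgebra_iff.mp ha g h).symm

theorem brauerMap_one (P : Subgroup G) : brauerMap k P 1 = 1 :=
  brauerMap_of_mem (Subalgebra.one_mem _)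

theorem brauerMap_brauerMap_of_le {P Q : Subgroup G} (h : Q ≤ P) (a : k[G]) :
    brauerMap k P (brauerMap k Q a) = brauerMap k P a := by
  classical
  ext g
  simp only [coeff_brauerMap]
  split_ifs with h1 h2
  · rfl
  · exact absurd (Subgroup.centralizer_le (by exact_mod_cast h) h1) h2
  · rfl

theorem mem_centralizer_map_conj {P : Subgroup G} {x g : G} :
    g ∈ Subgroup.centralizer (P.map (MulAut.conj x).toMonoidHom : Set G) ↔
      x⁻¹ * g * x ∈ Subgroup.centralizer (P : Set G) := by
  simp only [Subgroup.mem_centralizer_iff, Subgroup.coe_map, Set.forall_mem_image]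
  refine forall₂_congr fun u _ => ?_
  change x * u * x⁻¹ * g = g * (x * u * x⁻¹) ↔ _
  constructor
  · intro h
    calc u * (x⁻¹ * g * x) = x⁻¹ * (x * u * x⁻¹ * g) * x := by group
      _ = _ := by rw [h]; group
  · intro h
    calc x * u * x⁻¹ * g = x * (u * (x⁻¹ * g * x)) * x⁻¹ := by group
      _ = _ := by rw [h]; group

theorem conj_brauerMap (x : G) (P : Subgroup G) (a : k[G]) :
    conj k x (brauerMap k P a) =
      brauerMap k (P.map (MulAut.conj x).toMonoidHom) (conj k x a) := by
  classical
  ext g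
  simp only [coeff_conj, coeff_brauerMap, mem_centralizer_map_conj]

theorem map_conj_eq_self {P : Subgroup G} {x : G} (hx : x ∈ Subgroup.normalizer (P : Set G)) :
    P.map (MulAut.conj x).toMonoidHom = P := by
  ext g
  rw [Subgroup.mem_map_equiv, MulAut.conj_symm_apply]
  exact (Subgroup.mem_normalizer_iff''.mp hx g).symm

theorem brauerMap_mem_fixed {P T : Subgroup G} (h : T ≤ Subgroup.normalizer (P : Set G))
    {a : k[G]} (ha : a ∈ fixedSubalgebra k T) : brauerMap k P a ∈ fixedSubalgebra k T := by
  intro x hx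
  rw [conj_brauerMap, map_conj_eq_self (h hx), ha x hx]

theorem brauerMap_mem_center {P H : Subgroup G} (hPH : Subgroup.centralizer (P : Set G) ≤ H)
    {z : k[G]} (hz : z ∈ centerSubgroupAlgebra k H) :
    brauerMap k P z ∈ centerSubgroupAlgebra k (Subgroup.centralizer (P : Set G)) := by
  rw [mem_centerSubgroupAlgebra_iff]
  refine ⟨brauerMap_mem P z, brauerMap_mem_fixed ?_ ?_⟩
  · exact Subgroup.centralizer_le_normalizer (P : Set G)
  · exact fun x hx => (mem_centerSubgroupAlgebra_iff.mp hz).2 x (hPH hx)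

/-- The Brauer map only sees the fixed points in a sum over a finite set with an action of the
`p`-group `P`, if the summands are permuted accordingly. -/
theorem brauerMap_sum_eq {p : ℕ} [Fact p.Prime] [CharP k p] {P : Subgroup G} (hP : IsPGroup p P)
    {X : Type*} [Fintype X] [MulAction P X] (u : X → k[G])
    (hu : ∀ (h : P) (x : X), u (h • x) = conj k (h : G) (u x)) [DecidablePred
      fun x : X => x ∈ MulAction.fixedPoints P X] :
    brauerMap k P (∑ x, u x) = ∑ x with x ∈ MulAction.fixedPoints P X, brauerMap k P (u x) := by
  classical
  ext g
  rw [← brauerMap_sum]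
  simp only [coeff_brauerMap]
  split_ifs with hg
  · simp only [MonoidAlgebra.coeff_sum, Finsupp.finsetSum_apply]
    convert sum_eq_sum_fixedPoints hP (fun x => (u x).coeff g) ?_
    intro h x
    rw [hu, coeff_conj, mul_assoc, ← Subgroup.mem_centralizer_iff.mp hg h h.2, inv_mul_cancel_left]
  · rfl

/-- For `g ∈ C_G(P)` the coefficient of `a * b` at `g` is a sum over `G` whose terms are invariant
under conjugation by `P`. Modulo `p` only the fixed points, i.e. the elements of `C_G(P)`,
contribute. -/
theorem brauerMap_mul [Finite G] {p : ℕ} [Fact p.Prime] [CharP k p] {P : Subgroup G}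
    (hP : IsPGroup p P) {a b : k[G]} (ha : a ∈ fixedSubalgebra k P) (hb : b ∈ fixedSubalgebra k P) :
    brauerMap k P (a * b) = brauerMap k P a * brauerMap k P b := by
  classical
  have := Fintype.ofFinite G
  have hfix : ∀ c ∈ fixedSubalgebra k P, ∀ x ∈ P, ∀ g, c.coeff (x * g * x⁻¹) = c.coeff g := by
    intro c hc x hx g
    conv_rhs => rw [← hc x⁻¹ (inv_mem hx), coeff_conj, inv_inv]
  ext g
  by_cases hg : g ∈ Subgroup.centralizer (P : Set G)
  · rw [coeff_brauerMap, if_pos hg, coeff_mul_eq_sum, coeff_mul_eq_sum]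
    let _ : MulAction P G := MulAction.compHom G (MulAut.conj.comp P.subtype)
    have hsmul : ∀ (h : P) (x : G), h • x = h * x * (h : G)⁻¹ := fun _ _ => rfl
    rw [sum_eq_sum_fixedPoints hP (fun x => a.coeff x * b.coeff (x⁻¹ * g)), Finset.sum_filter]
    · refine Finset.sum_congr rfl fun x _ => ?_
      have hx : x ∈ MulAction.fixedPoints P G ↔ x ∈ Subgroup.centralizer (P : Set G) := by
        rw [MulAction.mem_fixedPoints, Subgroup.mem_centralizer_iff]
        constructor
        · intro h u hu
          have := h ⟨u, hu⟩
          rw [hsmul] at this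
          exact mul_inv_eq_iff_eq_mul.mp this
        · intro h u
          rw [hsmul, h u u.2, mul_inv_cancel_right]
      rw [coeff_brauerMap, coeff_brauerMap]
      by_cases hxc : x ∈ Subgroup.centralizer (P : Set G)
      · rw [if_pos (hx.mpr hxc), if_pos hxc, if_pos (mul_mem (inv_mem hxc) hg)]
      · rw [if_neg (fun h => hxc (hx.mp h)), if_neg hxc, zero_mul]
    · intro h x
      rw [hsmul, hfix a ha h h.2]
      congr 1
      rw [← hfix b hb h h.2 (x⁻¹ * g)]
      congr 1
      have := Subgroup.mem_centralizer_iff.mp hg h h.2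
      calc (h * x * (h : G)⁻¹)⁻¹ * g = h * x⁻¹ * (h : G)⁻¹ * (g * h) * (h : G)⁻¹ := by group
        _ = _ := by rw [← this]; group
  · rw [coeff_brauerMap, if_neg hg, mem_subgroupAlgebra_iff.mp
      (mul_mem (brauerMap_mem P a) (brauerMap_mem P b)) g hg]

theorem brauerMap_pow [Finite G] {p : ℕ} [Fact p.Prime] [CharP k p] {P : Subgroup G}
    (hP : IsPGroup p P) {a : k[G]} (ha : a ∈ fixedSubalgebra k P) (n : ℕ) :
    brauerMap k P (a ^ n) = brauerMap k P a ^ n := by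
  induction n with
  | zero => rw [pow_zero, pow_zero, brauerMap_one]
  | succ n ih => rw [pow_succ, brauerMap_mul hP (pow_mem ha n) ha, ih, pow_succ]

theorem conj_mem_subgroupAlgebra_iff {H : Subgroup G} {x : G} {a : k[G]} :
    conj k x a ∈ subgroupAlgebra k (H.map (MulAut.conj x).toMonoidHom) ↔
      a ∈ subgroupAlgebra k H := by
  rw [mem_subgroupAlgebra_iff, mem_subgroupAlgebra_iff]
  constructor
  · intro h g hg
    have := h (x * g * x⁻¹) fun hg' => hg (by
      rw [Subgroup.mem_map_equiv, MulAut.conj_symm_apply] at hg'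
      simpa [mul_assoc] using hg')
    simpa [mul_assoc] using this
  · intro h g hg
    rw [coeff_conj]
    refine h _ fun hg' => hg ?_
    rwa [Subgroup.mem_map_equiv, MulAut.conj_symm_apply]

theorem conj_mem_fixedSubalgebra_iff {P : Subgroup G} {x : G} {a : k[G]} :
    conj k x a ∈ fixedSubalgebra k (P.map (MulAut.conj x).toMonoidHom) ↔
      a ∈ fixedSubalgebra k P := by
  simp only [mem_fixedSubalgebra_iff]
  constructor
  · intro h u hu
    have := h (x * u * x⁻¹) ⟨u, hu, rfl⟩
    rw [← conj_mul_apply, inv_mul_cancel_right, conj_mul_apply] at this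
    exact (conj k x).injective this
  · rintro h _ ⟨u, hu, rfl⟩
    change conj k (x * u * x⁻¹) _ = _
    rw [← conj_mul_apply, inv_mul_cancel_right, conj_mul_apply, h u hu]

theorem conj_mem_center_iff {H : Subgroup G} {x : G} {a : k[G]} :
    conj k x a ∈ centerSubgroupAlgebra k (H.map (MulAut.conj x).toMonoidHom) ↔
      a ∈ centerSubgroupAlgebra k H := by
  rw [mem_centerSubgroupAlgebra_iff, mem_centerSubgroupAlgebra_iff, conj_mem_subgroupAlgebra_iff]
  exact and_congr_right fun _ => conj_mem_fixedSubalgebra_iff (P := H)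

theorem centralizer_map_conj (P : Subgroup G) (x : G) :
    Subgroup.centralizer (P.map (MulAut.conj x).toMonoidHom : Set G) =
      (Subgroup.centralizer (P : Set G)).map (MulAut.conj x).toMonoidHom := by
  ext g
  rw [mem_centralizer_map_conj, Subgroup.mem_map_equiv, MulAut.conj_symm_apply]

theorem IsBlockIdempotent.map_conj {H : Subgroup G} {b : k[G]} (hb : IsBlockIdempotent H b) (x : G) :
    IsBlockIdempotent (H.map (MulAut.conj x).toMonoidHom) (conj k x b) :=
  IsPrimitiveIdempotent.map (conj k x).toRingEquiv (fun _ => conj_mem_center_iff) hb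

theorem IsPrimitiveIdempotent.map_conj {P : Subgroup G} {i : k[G]}
    (hi : IsPrimitiveIdempotent (fixedSubalgebra k P) i) (x : G) :
    IsPrimitiveIdempotent (fixedSubalgebra k (P.map (MulAut.conj x).toMonoidHom)) (conj k x i) :=
  IsPrimitiveIdempotent.map (conj k x).toRingEquiv
    (fun _ => conj_mem_fixedSubalgebra_iff) hi

theorem IsAssociated.map_conj {i : k[G]} {y : Subgroup G × k[G]} (h : IsAssociated i y) (x : G) :
    IsAssociated (conj k x i) (conjPair x y) := by
  unfold IsAssociated conjPair
  rw [← conj_brauerMap, ← map_mul, h.1]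
  exact ⟨rfl, by simpa using h.2⟩

theorem BrauerLE.map_conj {y z : Subgroup G × k[G]} (h : BrauerLE y z) (x : G) :
    BrauerLE (conjPair x y) (conjPair x z) := by
  refine ⟨Subgroup.map_mono h.1, fun i hi hiz => ?_⟩
  have hi' := hi.map_conj x⁻¹
  have hz : conjPair x⁻¹ (conjPair x z) = z := by
    rw [← conjPair_mul, inv_mul_cancel, conjPair_one]
  have hz1 : ((conjPair x z).1).map (MulAut.conj x⁻¹).toMonoidHom = z.1 := congrArg Prod.fst hz
  rw [hz1] at hi'
  have := (h.2 _ hi' (hz ▸ hiz.map_conj x⁻¹)).map_conj x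
  rwa [conj_conj_inv] at this

theorem IsBrauerPair.map_conj {p : ℕ} {y : Subgroup G × k[G]} (h : IsBrauerPair p y) (x : G) :
    IsBrauerPair p (conjPair x y) := by
  refine ⟨h.1.map _, ?_⟩
  have := h.2.map_conj x
  rwa [← centralizer_map_conj] at this

theorem conj_top_of_mem_center {b : k[G]} (hb : b ∈ centerSubgroupAlgebra k (⊤ : Subgroup G))
    (x : G) : conj k x b = b := (mem_centerSubgroupAlgebra_iff.mp hb).2 x trivial

theorem IsBlockBrauerPair.map_conj {p : ℕ} {b : k[G]}
    (hb : b ∈ centerSubgroupAlgebra k (⊤ : Subgroup G)) {y : Subgroup G × k[G]}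
    (h : IsBlockBrauerPair p b y) (x : G) : IsBlockBrauerPair p b (conjPair x y) := by
  refine ⟨h.1.map_conj x, ?_⟩
  change brauerMap k _ b * conj k x y.2 = conj k x y.2
  rw [← conj_top_of_mem_center hb x]
  change brauerMap k (y.1.map _) _ * _ = _
  rw [← conj_brauerMap, ← map_mul, h.2]

end GroupAlgebra

/-! ### Brauer pairs and their inclusion: the Alperin–Broué theorem. -/

section BrauerPairs

variable {k : Type*} [Field k] {G : Type*} [Group G]

theorem lt_inf_normalizer [Finite G] {p : ℕ} [Fact p.Prime] {R Q : Subgroup G} (hR : IsPGroup p R)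
    (hQR : Q < R) : Q < R ⊓ Subgroup.normalizer (Q : Set G) := by
  have hnil : Group.IsNilpotent R := hR.isNilpotent
  have hlt : Q.subgroupOf R < ⊤ := by
    rw [lt_top_iff_ne_top, Ne, Subgroup.subgroupOf_eq_top]
    exact not_le_of_gt hQR
  obtain ⟨x, hx, hxQ⟩ := SetLike.exists_of_lt (Group.normalizerCondition_of_isNilpotent _ hlt)
  refine SetLike.lt_iff_le_and_exists.mpr
    ⟨le_inf hQR.le Subgroup.le_normalizer, (x : G), Subgroup.mem_inf.mpr ⟨x.2, ?_⟩, fun h => hxQ h⟩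
  rw [Subgroup.mem_normalizer_iff] at hx ⊢
  intro u
  constructor
  · intro hu
    exact (hx ⟨u, hQR.le hu⟩).mp hu
  · intro hu
    have huR : u ∈ R := by
      have := mul_mem (mul_mem (inv_mem x.2) (hQR.le hu)) x.2
      simpa [mul_assoc] using this
    exact (hx ⟨u, huR⟩).mpr hu

/-- If `C_P(g)` were strictly larger than `Q`, its subgroup normalizing `Q` would be so too. The
Brauer map of that subgroup keeps the coefficient of `a` at `g`, contrary to the vanishing
hypothesis. -/
theorem mem_of_commute_of_brauerMap_eq_zero [Finite G] {p : ℕ} [Fact p.Prime] {P Q : Subgroup G}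
    (hP : IsPGroup p P) (hQP : Q ≤ P) {a : k[G]}
    (hz : ∀ T, Q < T → T ≤ P ⊓ Subgroup.normalizer (Q : Set G) → brauerMap k T a = 0)
    {g : G} (hg : a.coeff g ≠ 0) (hgQ : g ∈ Subgroup.centralizer (Q : Set G))
    {y : G} (hy : y ∈ P) (hyg : y * g = g * y) : y ∈ Q := by
  classical
  by_contra hyQ
  set R := P ⊓ Subgroup.centralizer {g} with hRdef
  have hmemR : ∀ u, u ∈ R ↔ u ∈ P ∧ u * g = g * u := by
    intro u
    rw [hRdef, Subgroup.mem_inf, Subgroup.mem_centralizer_singleton_iff]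
  have hQR : Q < R := by
    refine SetLike.lt_iff_le_and_exists.mpr ⟨fun u hu => (hmemR u).mpr ⟨hQP hu, ?_⟩, y,
      (hmemR y).mpr ⟨hy, hyg⟩, hyQ⟩
    exact Subgroup.mem_centralizer_iff.mp hgQ u hu
  have hT := lt_inf_normalizer (hP.to_le inf_le_left : IsPGroup p R) hQR
  have h0 := hz _ hT (inf_le_inf_right _ inf_le_left)
  have h1 := congrArg (fun c : k[G] => c.coeff g) h0
  simp only [coeff_brauerMap, MonoidAlgebra.coeff_zero, Finsupp.coe_zero, Pi.zero_apply] at h1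
  rw [if_pos] at h1
  · exact hg h1
  · rw [Subgroup.mem_centralizer_iff]
    exact fun u hu => ((hmemR u).mp (Subgroup.mem_inf.mp hu).1).2

/-- An element of `kC_G(Q)` fixed by `N_P(Q)` which vanishes under the Brauer maps of all larger
subgroups of `N_P(Q)` is the image of an element of `(kG)^P` in the kernel of `Br_P`. -/
theorem exists_brauerMap_eq [Finite G] {p : ℕ} [Fact p.Prime] {P Q : Subgroup G}
    (hP : IsPGroup p P) (hQP : Q < P) {a : k[G]}
    (ha : a ∈ subgroupAlgebra k (Subgroup.centralizer (Q : Set G)))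
    (haS : a ∈ fixedSubalgebra k (P ⊓ Subgroup.normalizer (Q : Set G)))
    (hz : ∀ T, Q < T → T ≤ P ⊓ Subgroup.normalizer (Q : Set G) → brauerMap k T a = 0) :
    ∃ c ∈ fixedSubalgebra k P, brauerMap k P c = 0 ∧ brauerMap k Q c = a := by
  classical
  have hsupp : ∀ g, a.coeff g ≠ 0 → g ∈ Subgroup.centralizer (Q : Set G) := by
    intro g hg
    by_contra h
    exact hg (mem_subgroupAlgebra_iff.mp ha g h)
  have hstab : ∀ g, a.coeff g ≠ 0 → ∀ y ∈ P, y * g = g * y → y ∈ Q := fun g hg y hy hyg =>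
    mem_of_commute_of_brauerMap_eq_zero hP hQP.le hz hg (hsupp g hg) hy hyg
  have hcomm : ∀ (g : G), g ∈ Subgroup.centralizer (Q : Set G) → ∀ u ∈ Q, u * g = g * u :=
    fun g hg u hu => Subgroup.mem_centralizer_iff.mp hg u hu
  have hconj : ∀ h ∈ Subgroup.centralizer (Q : Set G), ∀ y ∈ P, a.coeff (y⁻¹ * h * y) ≠ 0 →
      a.coeff (y⁻¹ * h * y) = a.coeff h := by
    intro h hh y hy hne
    -- `Q` centralizes `h`, so `y⁻¹Qy` centralizes the support element `y⁻¹hy`; by `hstab` it lies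
    -- in `Q`. Thus fusion by `P` inside the support of `a` is already fusion by `N_P(Q)`, which
    -- fixes `a`.
    have hyN : y⁻¹ ∈ Subgroup.normalizer (Q : Set G) := by
      refine Subgroup.mem_normalizer_fintype fun u hu => ?_
      refine hstab _ hne _ (mul_mem (mul_mem (inv_mem hy) (hQP.le hu)) (inv_mem (inv_mem hy))) ?_
      have := hcomm h hh u hu
      calc y⁻¹ * u * y⁻¹⁻¹ * (y⁻¹ * h * y) = y⁻¹ * (u * h) * y := by group
        _ = _ := by rw [this]; group
    have h1 := haS y ⟨hy, by simpa using inv_mem hyN⟩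
    conv_rhs => rw [← h1, coeff_conj]
  have hwell : ∀ h : G, ∀ y ∈ P, ∀ z ∈ P, a.coeff (y⁻¹ * h * y) ≠ 0 → a.coeff (z⁻¹ * h * z) ≠ 0 →
      a.coeff (y⁻¹ * h * y) = a.coeff (z⁻¹ * h * z) := by
    intro h y hy z hz' hne hne'
    have h1 : (y⁻¹ * z)⁻¹ * (y⁻¹ * h * y) * (y⁻¹ * z) = z⁻¹ * h * z := by group
    have h2 := hconj _ (hsupp _ hne) (y⁻¹ * z) (mul_mem (inv_mem hy) hz')
    rw [h1] at h2
    exact (h2 hne').symm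
  -- The lift spreads `a` along `P`-conjugacy classes: `r h` is the coefficient of `a` at any
  -- `P`-conjugate of `h` in its support, and `0` if there is none.
  have hex : ∀ h : G, ∃ r : k, (∀ y ∈ P, a.coeff (y⁻¹ * h * y) ≠ 0 → r = a.coeff (y⁻¹ * h * y)) ∧
      ((∀ y ∈ P, a.coeff (y⁻¹ * h * y) = 0) → r = 0) := by
    intro h
    by_cases hh : ∃ y ∈ P, a.coeff (y⁻¹ * h * y) ≠ 0
    · obtain ⟨y, hy, hne⟩ := hh
      exact ⟨a.coeff (y⁻¹ * h * y), fun z hz' hne' => hwell h y hy z hz' hne hne',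
        fun hall => absurd (hall y hy) hne⟩
    · push Not at hh
      exact ⟨0, fun y hy hne => absurd (hh y hy) hne, fun _ => rfl⟩
  choose r hr1 hr2 using hex
  have hrne : ∀ h, r h ≠ 0 → ∃ y ∈ P, a.coeff (y⁻¹ * h * y) ≠ 0 := by
    intro h hne
    by_contra hcon
    push Not at hcon
    exact hne (hr2 h hcon)
  have hrinv : ∀ x ∈ P, ∀ h, r (x⁻¹ * h * x) = r h := by
    intro x hx h
    by_cases hh : ∃ y ∈ P, a.coeff (y⁻¹ * h * y) ≠ 0
    · obtain ⟨y, hy, hne⟩ := hh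
      have h1 : (x⁻¹ * y)⁻¹ * (x⁻¹ * h * x) * (x⁻¹ * y) = y⁻¹ * h * y := by group
      rw [hr1 h y hy hne, hr1 (x⁻¹ * h * x) (x⁻¹ * y) (mul_mem (inv_mem hx) hy) (h1 ▸ hne), h1]
    · push Not at hh
      rw [hr2 h hh]
      refine hr2 _ fun y hy => ?_
      have h1 : y⁻¹ * (x⁻¹ * h * x) * y = (x * y)⁻¹ * h * (x * y) := by group
      rw [h1]
      exact hh _ (mul_mem hx hy)
  refine ⟨MonoidAlgebra.ofCoeff (Finsupp.ofSupportFinite r (Set.toFinite _)), ?_, ?_, ?_⟩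
  · intro x hx
    ext h
    rw [coeff_conj]
    exact hrinv x hx h
  · ext h
    rw [coeff_brauerMap]
    split_ifs with hh
    · change r h = 0
      by_contra hne
      obtain ⟨y, hy, hne'⟩ := hrne h hne
      have h1 : y⁻¹ * h * y = h := by
        have := Subgroup.mem_centralizer_iff.mp hh y hy
        rw [mul_assoc, ← this, inv_mul_cancel_left]
      rw [h1] at hne'
      exact not_le_of_gt hQP fun u hu =>
        hstab h hne' u hu (Subgroup.mem_centralizer_iff.mp hh u hu)
    · rfl
  · ext h
    rw [coeff_brauerMap]
    split_ifs with hh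
    · change r h = a.coeff h
      by_cases hne : ∃ y ∈ P, a.coeff (y⁻¹ * h * y) ≠ 0
      · obtain ⟨y, hy, hne⟩ := hne
        rw [hr1 h y hy hne, hconj h hh y hy hne]
      · push Not at hne
        rw [hr2 h hne]
        simpa using (hne 1 (one_mem P)).symm
    · exact (mem_subgroupAlgebra_iff.mp ha h hh).symm

theorem IsBlockIdempotent.mul_eq_zero_or_eq {H : Subgroup G} {e z : k[G]}
    (he : IsBlockIdempotent H e) (hz : z ∈ centerSubgroupAlgebra k H) (hzz : z * z = z) :
    z * e = 0 ∨ z * e = e :=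
  IsPrimitiveIdempotent.mul_eq_zero_or_eq he hz hzz (center_mul_comm H _ hz _ he.mem)

theorem IsBlockIdempotent.eq_of_mul_ne_zero {H : Subgroup G} {e f : k[G]}
    (he : IsBlockIdempotent H e) (hf : IsBlockIdempotent H f) (h : e * f ≠ 0) : e = f :=
  (IsPrimitiveIdempotent.mul_eq_zero_or_eq_of_comm (center_mul_comm H) he hf).resolve_left h

theorem IsBrauerPair.mul_comm {p : ℕ} {P : Subgroup G} {e : k[G]} (h : IsBrauerPair p (P, e)) (a : k[G]) :
    brauerMap k P a * e = e * brauerMap k P a :=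
  mul_comm_of_mem_center h.2.mem (brauerMap_mem P a)

theorem BrauerLE.refl (y : Subgroup G × k[G]) : BrauerLE y y := ⟨le_rfl, fun _ _ hi => hi⟩

variable [Finite G] {p : ℕ} [Fact p.Prime] [CharP k p]

/-- `Br_P(i * e * i) = Br_P(i) * e` is a non-zero idempotent, so `i * e * i` is not nilpotent and is
therefore invertible under `i`. Applying `Br_P` to `w * (i * e * i) = i` shows that `Br_P(i)` is
fixed by `e`. -/
theorem IsBrauerPair.isAssociated {P : Subgroup G} {e i : k[G]} (h : IsBrauerPair p (P, e))
    (hi : IsPrimitiveIdempotent (fixedSubalgebra k P) i) (hne : brauerMap k P i * e ≠ 0) :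
    IsAssociated i (P, e) := by
  have hP : IsPGroup p P := h.1
  have heC := mem_subgroupAlgebra_of_mem_center h.2.mem
  have heP := subgroupAlgebra_centralizer_le P heC
  have hee : e * e = e := h.2.idem
  have hBr : brauerMap k P (i * e * i) = brauerMap k P i * e := by
    rw [brauerMap_mul hP (mul_mem hi.mem heP) hi.mem, brauerMap_mul hP hi.mem heP,
      brauerMap_of_mem heC, mul_assoc, ← h.mul_comm, ← mul_assoc, ← brauerMap_mul hP hi.mem hi.mem,
      hi.idem]
  have hidem : (brauerMap k P i * e) * (brauerMap k P i * e) = brauerMap k P i * e := by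
    rw [mul_assoc, ← mul_assoc e, ← h.mul_comm, mul_assoc _ e e, hee, ← mul_assoc,
      ← brauerMap_mul hP hi.mem hi.mem, hi.idem]
  refine ⟨?_, fun h0 => hne (by rw [h0, zero_mul])⟩
  change e * brauerMap k P i = brauerMap k P i
  rcases hi.isNilpotent_or_exists_mul_eq (mul_mem (mul_mem hi.mem heP) hi.mem)
    (by rw [← mul_assoc, ← mul_assoc, hi.idem]) (by rw [mul_assoc, hi.idem]) with hn | ⟨w, hw, hwi⟩
  · obtain ⟨n, hn⟩ := hn
    exfalso
    apply hne
    have h1 := brauerMap_pow hP (mul_mem (mul_mem hi.mem heP) hi.mem) n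
    rw [hn, brauerMap_zero, hBr] at h1
    exact IsIdempotentElem.eq_zero_of_isNilpotent hidem ⟨n, h1.symm⟩
  · have h1 : brauerMap k P i = brauerMap k P w * (brauerMap k P i * e) := by
      conv_lhs => rw [← hwi, brauerMap_mul hP hw (mul_mem (mul_mem hi.mem heP) hi.mem), hBr]
    rw [← h.mul_comm]
    conv_lhs => rw [h1, mul_assoc, mul_assoc, hee]
    exact h1.symm

theorem IsBrauerPair.exists_isAssociated {P : Subgroup G} {e i : k[G]} (h : IsBrauerPair p (P, e))
    (hi : i ∈ fixedSubalgebra k P) (hii : i * i = i) (hne : brauerMap k P i * e ≠ 0) :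
    ∃ j, IsPrimitiveIdempotent (fixedSubalgebra k P) j ∧ i * j = j ∧ j * i = j ∧
      IsAssociated j (P, e) := by
  obtain ⟨j, hj, h1, h2, h3⟩ := exists_isPrimitiveIdempotent (S := fixedSubalgebra k P)
    (fun x => brauerMap k P x * e ≠ 0) (by simp [brauerMap_zero])
    (fun x _ y _ hxy => by
      by_contra hcon
      push Not at hcon
      exact hxy (by rw [brauerMap_add, add_mul, hcon.1, hcon.2, add_zero])) hi hii hne
  exact ⟨j, hj, h1, h2, h.isAssociated hj h3⟩

theorem IsBrauerPair.exists_isAssociated_one {P : Subgroup G} {e : k[G]}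
    (h : IsBrauerPair p (P, e)) :
    ∃ j, IsPrimitiveIdempotent (fixedSubalgebra k P) j ∧ IsAssociated j (P, e) := by
  obtain ⟨j, hj, -, -, h1⟩ := h.exists_isAssociated (one_mem _) (one_mul 1)
    (by rw [brauerMap_one, one_mul]; exact h.2.ne_zero)
  exact ⟨j, hj, h1⟩

/-- `S` permutes the blocks of `kC_G(Q)`, whose sum is `1`. Under `Br_S` only the `S`-stable blocks
survive, and one of them must not kill `e`. -/
theorem IsBrauerPair.exists_stable_block {Q S : Subgroup G} {e : k[G]} (h : IsBrauerPair p (S, e))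
    (hQS : Q ≤ S) (hSN : S ≤ Subgroup.normalizer (Q : Set G)) :
    ∃ f, IsBlockIdempotent (Subgroup.centralizer (Q : Set G)) f ∧ f ∈ fixedSubalgebra k S ∧
      brauerMap k S f * e = e := by
  classical
  set C := Subgroup.centralizer (Q : Set G)
  have hCS : Subgroup.centralizer (S : Set G) ≤ C := Subgroup.centralizer_le (by exact_mod_cast hQS)
  have hfin := finite_isPrimitiveIdempotent (center_mul_comm (k := k) C)
  let X := {f : k[G] // IsBlockIdempotent C f}
  have : Fintype X := hfin.fintype
  have hconj : ∀ s ∈ S, ∀ f : k[G], IsBlockIdempotent C f → IsBlockIdempotent C (conj k s f) := by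
    intro s hs f hf
    have := hf.map_conj s
    rwa [← centralizer_map_conj, map_conj_eq_self (hSN hs)] at this
  let _ : MulAction S X :=
    { smul := fun s f => ⟨conj k (s : G) f.1, hconj s s.2 f.1 f.2⟩
      one_smul := fun f => Subtype.ext (conj_one_apply f.1)
      mul_smul := fun s t f => Subtype.ext (conj_mul_apply (s : G) (t : G) f.1) }
  have hsum : ∑ f : X, f.1 = 1 := by
    rw [← sum_isPrimitiveIdempotent (center_mul_comm (k := k) C) hfin.toFinset (by simp)]
    exact (Finset.sum_subtype hfin.toFinset (by simp [IsBlockIdempotent]) (fun f => f)).symm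
  have h1 := brauerMap_sum_eq h.1 (fun f : X => f.1) (fun _ _ => rfl)
  rw [hsum, brauerMap_one] at h1
  have h2 : ∑ f : X with f ∈ MulAction.fixedPoints S X, brauerMap k S f.1 * e ≠ 0 := by
    rw [← Finset.sum_mul, ← h1, one_mul]
    exact h.2.ne_zero
  obtain ⟨f, hf, hne⟩ := Finset.exists_ne_zero_of_sum_ne_zero h2
  have hfS : f.1 ∈ fixedSubalgebra k S := by
    intro s hs
    exact congrArg Subtype.val ((Finset.mem_filter.mp hf).2 ⟨s, hs⟩)
  refine ⟨f.1, f.2, hfS, ?_⟩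
  refine (h.2.mul_eq_zero_or_eq (brauerMap_mem_center hCS f.2.mem) ?_).resolve_left hne
  rw [← brauerMap_mul h.1 hfS hfS, f.2.idem]

/-- The inductive step of the existence theorem, from the groups above `Q` to `Q`. The error term `a
= Br_Q(i) - f * Br_Q(i)` is an idempotent killed by `Br_T` for every `T` with `Q < T ≤ N_P(Q)`. It
lifts to some `c` in the kernel of `Br_P`, and locality at `i` forces `a = 0`. -/
theorem isAssociated_of_stable_block {P Q : Subgroup G} {i f eS : k[G]}
    (hP : IsPGroup p P) (hQP : Q < P) (hi : IsPrimitiveIdempotent (fixedSubalgebra k P) i)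
    (hiP : brauerMap k P i ≠ 0)
    (hf : IsBlockIdempotent (Subgroup.centralizer (Q : Set G)) f)
    (hfS : f ∈ fixedSubalgebra k (P ⊓ Subgroup.normalizer (Q : Set G)))
    (hS : IsAssociated i (P ⊓ Subgroup.normalizer (Q : Set G), eS))
    (hfe : brauerMap k (P ⊓ Subgroup.normalizer (Q : Set G)) f * eS = eS)
    (hT : ∀ T, Q < T → T ≤ P → ∃ eT, IsBrauerPair p (T, eT) ∧ IsAssociated i (T, eT)) :
    IsAssociated i (Q, f) := by
  set S := P ⊓ Subgroup.normalizer (Q : Set G) with hSdef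
  have hQS : Q ≤ S := le_inf hQP.le Subgroup.le_normalizer
  have hpS : IsPGroup p S := hP.to_le inf_le_left
  have hfC := mem_subgroupAlgebra_of_mem_center hf.mem
  have hiS := fixedSubalgebra_anti (k := k) (inf_le_left : S ≤ P) hi.mem
  have hiQ := fixedSubalgebra_anti (k := k) hQP.le hi.mem
  have hBiS : brauerMap k Q i ∈ fixedSubalgebra k S := brauerMap_mem_fixed inf_le_right hiS
  have hpQ : IsPGroup p Q := hP.to_le hQP.le
  have hBii : brauerMap k Q i * brauerMap k Q i = brauerMap k Q i := by
    rw [← brauerMap_mul hpQ hiQ hiQ, hi.idem]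
  have hfi : f * brauerMap k Q i = brauerMap k Q i * f :=
    (mul_comm_of_mem_center hf.mem (brauerMap_mem Q i)).symm
  set a := brauerMap k Q i - f * brauerMap k Q i with ha
  have hia : brauerMap k Q i * a = a := by
    rw [ha, mul_sub, hBii, hfi, ← mul_assoc, hBii]
  have hai : a * brauerMap k Q i = a := by
    rw [ha, sub_mul, hBii, mul_assoc, hBii]
  have hfa : f * a = 0 := by
    rw [ha, mul_sub, ← mul_assoc, hf.idem, sub_self]
  have haa : a * a = a := by
    conv_lhs => rw [ha, sub_mul, hia, mul_assoc, hia, hfa, sub_zero]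
  have hprodS : brauerMap k S (f * brauerMap k Q i) = brauerMap k S i := by
    rw [brauerMap_mul hpS hfS hBiS, brauerMap_brauerMap_of_le hQS, ← hS.1, ← mul_assoc]
    exact congrArg (· * _) hfe
  have haT : ∀ T, Q < T → T ≤ S → brauerMap k T a = 0 := by
    intro T hQT hTS
    have hpT : IsPGroup p T := hpS.to_le hTS
    obtain ⟨eT, heT, hiT⟩ := hT T hQT (hTS.trans inf_le_left)
    have hfT := fixedSubalgebra_anti (k := k) hTS hfS
    have hBf : brauerMap k T f ∈ centerSubgroupAlgebra k (Subgroup.centralizer (T : Set G)) :=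
      brauerMap_mem_center (Subgroup.centralizer_le (by exact_mod_cast hQT.le)) hf.mem
    have hprod : brauerMap k T (f * brauerMap k Q i) = brauerMap k T f * eT * brauerMap k T i := by
      rw [brauerMap_mul hpT hfT (fixedSubalgebra_anti hTS hBiS), brauerMap_brauerMap_of_le hQT.le,
        mul_assoc]
      exact congrArg _ hiT.1.symm
    rw [ha, brauerMap_sub, brauerMap_brauerMap_of_le hQT.le]
    -- If `Br_T(f)` killed `eT`, then `Br_T(f * Br_Q(i))` would vanish, and with it `Br_S(i)`. So
    -- `Br_T(f)` fixes `eT`, and `f` does not change `Br_T(i)`.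
    rcases heT.2.mul_eq_zero_or_eq hBf (by rw [← brauerMap_mul hpT hfT hfT, hf.idem]) with h0 | h1
    · exfalso
      apply hS.2
      change brauerMap k S i = 0
      rw [← hprodS, ← brauerMap_brauerMap_of_le hTS, hprod]
      rw [show brauerMap k T f * eT = 0 from h0, zero_mul, brauerMap_zero]
    · rw [hprod, show brauerMap k T f * eT = eT from h1, show eT * _ = _ from hiT.1, sub_self]
  have haC : a ∈ subgroupAlgebra k (Subgroup.centralizer (Q : Set G)) :=
    sub_mem (brauerMap_mem Q i) (mul_mem hfC (brauerMap_mem Q i))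
  have haS : a ∈ fixedSubalgebra k S := sub_mem hBiS (mul_mem hfS hBiS)
  obtain ⟨c, hc, hcP, hcQ⟩ := exists_brauerMap_eq hP hQP haC haS haT
  have hcQ' := fixedSubalgebra_anti (k := k) hQP.le hc
  have hici : i * c * i ∈ fixedSubalgebra k P := mul_mem (mul_mem hi.mem hc) hi.mem
  have ha0 : a = 0 := by
    -- If `i * c * i` is nilpotent, so is its image `a` under `Br_Q`, and an idempotent nilpotent is
    -- `0`. If it is invertible under `i`, then `Br_P(c) = 0` gives `Br_P(i) = 0`.
    rcases hi.isNilpotent_or_exists_mul_eq hici (by rw [← mul_assoc, ← mul_assoc, hi.idem])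
      (by rw [mul_assoc, hi.idem]) with ⟨n, hn⟩ | ⟨w, hw, hwi⟩
    · have h1 := brauerMap_pow hpQ (fixedSubalgebra_anti hQP.le hici) n
      rw [hn, brauerMap_zero, brauerMap_mul hpQ (mul_mem hiQ hcQ') hiQ, brauerMap_mul hpQ hiQ hcQ',
        hcQ, hia, hai] at h1
      exact IsIdempotentElem.eq_zero_of_isNilpotent haa ⟨n, h1.symm⟩
    · exfalso
      apply hiP
      rw [← hwi, brauerMap_mul hP hw hici, brauerMap_mul hP (mul_mem hi.mem hc) hi.mem,
        brauerMap_mul hP hi.mem hc, hcP, mul_zero, zero_mul, mul_zero]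
  refine ⟨(sub_eq_zero.mp ha0).symm, fun h0 => hiP ?_⟩
  change brauerMap k Q i = 0 at h0
  rw [← brauerMap_brauerMap_of_le hQP.le, h0, brauerMap_zero]

/-- Existence in the theorem of Alperin and Broué on the inclusion of Brauer pairs. -/
theorem IsBrauerPair.exists_brauerLE {P : Subgroup G} {e : k[G]} (h : IsBrauerPair p (P, e))
    {Q : Subgroup G} (hQP : Q ≤ P) : ∃ f, IsBrauerPair p (Q, f) ∧ BrauerLE (Q, f) (P, e) := by
  -- The induction descends: the statement for `Q` uses all larger subgroups of `P`, in particular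
  -- `N_P(Q)`.
  induction Q using WellFoundedGT.induction with
  | _ Q ih =>
  rcases hQP.eq_or_lt with rfl | hlt
  · exact ⟨e, h, le_rfl, fun _ _ hi => hi⟩
  · have hlt' := lt_inf_normalizer h.1 hlt
    obtain ⟨eS, heS, hle⟩ := ih _ hlt' inf_le_left
    obtain ⟨f, hf, hfS, hfe⟩ := heS.exists_stable_block hlt'.le inf_le_right
    refine ⟨f, ⟨h.1.to_le hQP, hf⟩, hQP, fun i hi hiP => ?_⟩
    refine isAssociated_of_stable_block h.1 hlt hi hiP.2 hf hfS (hle.2 i hi hiP) hfe ?_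
    intro T hT hTP
    obtain ⟨eT, heT, hleT⟩ := ih T hT hTP
    exact ⟨eT, heT, hleT.2 i hi hiP⟩

/-- Uniqueness in the theorem of Alperin and Broué on the inclusion of Brauer pairs. -/
theorem IsBrauerPair.brauerLE_unique {P Q : Subgroup G} {e f f' : k[G]}
    (h : IsBrauerPair p (P, e)) (hf : IsBrauerPair p (Q, f)) (hf' : IsBrauerPair p (Q, f'))
    (hle : BrauerLE (Q, f) (P, e)) (hle' : BrauerLE (Q, f') (P, e)) : f = f' := by
  obtain ⟨i, hi, hiP⟩ := h.exists_isAssociated_one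
  have h1 := hle.2 i hi hiP
  have h2 := hle'.2 i hi hiP
  refine hf.2.eq_of_mul_ne_zero hf'.2 fun h0 => h1.2 ?_
  change brauerMap k Q i = 0
  rw [← h1.1, ← h2.1]
  change f * (f' * _) = 0
  rw [← mul_assoc, show f * f' = 0 from h0, zero_mul]

/-- The definition does not give this at once, since an idempotent primitive in `(kG)^P` may split
in `(kG)^R`. A primitive component `j` in `(kG)^R` associated to `y` sees both `f` and the block
`f'` of `kC_G(Q)` below `z`, so `f = f'`. -/
theorem BrauerLE.trans {x y z : Subgroup G × k[G]} (hx : IsBrauerPair p x) (hy : IsBrauerPair p y)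
    (hz : IsBrauerPair p z) (hxy : BrauerLE x y) (hyz : BrauerLE y z) : BrauerLE x z := by
  obtain ⟨Q, f⟩ := x
  obtain ⟨R, g⟩ := y
  obtain ⟨P, e⟩ := z
  have hQR : Q ≤ R := hxy.1
  have hRP : R ≤ P := hyz.1
  obtain ⟨f', hf', hle⟩ := hz.exists_brauerLE (hQR.trans hRP)
  suffices f = f' by rwa [this]
  obtain ⟨i, hi, hiP⟩ := hz.exists_isAssociated_one
  have hiR := hyz.2 i hi hiP
  have hiQ := hle.2 i hi hiP
  have hi_mem := fixedSubalgebra_anti (k := k) hRP hi.mem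
  obtain ⟨j, hj, h1, h2, h3⟩ := hy.exists_isAssociated hi_mem hi.idem (by
    rw [hy.mul_comm, show g * _ = _ from hiR.1]; exact hiR.2)
  have h4 := hxy.2 j hj h3
  have hpQ : IsPGroup p Q := hx.1
  refine hx.2.eq_of_mul_ne_zero hf'.2 fun h0 => h4.2 ?_
  change brauerMap k Q j = 0
  have h5 : f' * brauerMap k Q j = brauerMap k Q j := by
    rw [← h1, brauerMap_mul hpQ (fixedSubalgebra_anti hQR hi_mem)
      (fixedSubalgebra_anti hQR hj.mem), ← mul_assoc, show f' * _ = _ from hiQ.1]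
  rw [← h4.1, ← h5]
  change f * (f' * _) = 0
  rw [← mul_assoc, show f * f' = 0 from h0, zero_mul]

theorem BrauerLE.of_le_of_le {Q R P : Subgroup G} {e f g : k[G]} (hQ : IsBrauerPair p (Q, f))
    (hR : IsBrauerPair p (R, g)) (hP : IsBrauerPair p (P, e)) (hQP : BrauerLE (Q, f) (P, e))
    (hRP : BrauerLE (R, g) (P, e)) (hQR : Q ≤ R) : BrauerLE (Q, f) (R, g) := by
  obtain ⟨f', hf', hle⟩ := hR.exists_brauerLE hQR
  rwa [hP.brauerLE_unique hQ hf' hQP (hle.trans hf' hR hP hRP)]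

/-- A primitive idempotent associated to `y` lies in the block `b`, and it is also associated to
`x`. -/
theorem IsBlockBrauerPair.of_brauerLE {b : k[G]} (hb : IsBlockIdempotent (⊤ : Subgroup G) b)
    {x y : Subgroup G × k[G]} (hx : IsBrauerPair p x) (hy : IsBlockBrauerPair p b y)
    (h : BrauerLE x y) : IsBlockBrauerPair p b x := by
  obtain ⟨P, e⟩ := x
  obtain ⟨R, f⟩ := y
  have hPR : P ≤ R := h.1
  obtain ⟨i, hi, hiR⟩ := hy.1.exists_isAssociated_one
  have hiP := h.2 i hi hiR
  have hbfix : ∀ T : Subgroup G, b ∈ fixedSubalgebra k T :=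
    fun T x _ => conj_top_of_mem_center hb.mem x
  have hpR : IsPGroup p R := hy.1.1
  have hpP : IsPGroup p P := hx.1
  have hbi : b * i = i := by
    refine (hi.mul_eq_zero_or_eq (hbfix R) hb.idem ?_).resolve_left fun h0 => hiR.2 ?_
    · exact (mul_comm_of_mem_center hb.mem (mem_subgroupAlgebra_iff.mpr
        fun g hg => absurd trivial hg)).symm
    · change brauerMap k R i = 0
      have h1 := brauerMap_mul hpR (hbfix R) hi.mem
      rw [h0, brauerMap_zero, ← hiR.1] at h1
      change 0 = brauerMap k R b * (f * _) at h1
      rw [← mul_assoc, show brauerMap k R b * f = f from hy.2] at h1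
      rw [← hiR.1]
      exact h1.symm
  refine ⟨hx, ?_⟩
  change brauerMap k P b * e = e
  refine (hx.2.mul_eq_zero_or_eq (brauerMap_mem_center le_top hb.mem)
    (by rw [← brauerMap_mul hpP (hbfix P) (hbfix P), hb.idem])).resolve_left fun h0 => hiP.2 ?_
  change brauerMap k P i = 0
  rw [← hbi, brauerMap_mul hpP (hbfix P) (fixedSubalgebra_anti hPR hi.mem), ← hiP.1, ← mul_assoc]
  rw [show brauerMap k P b * e = 0 from h0, zero_mul]

theorem IsBrauerPair.exists_isBlockBrauerPair {x : Subgroup G × k[G]} (hx : IsBrauerPair p x) :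
    ∃ b, IsBlockIdempotent (⊤ : Subgroup G) b ∧ IsBlockBrauerPair p b x := by
  obtain ⟨b, hb, -, -, hne⟩ := exists_isPrimitiveIdempotent
    (S := centerSubgroupAlgebra k (⊤ : Subgroup G)) (i := 1)
    (fun z => brauerMap k x.1 z * x.2 ≠ 0) (by simp [brauerMap_zero])
    (fun y _ z _ hyz => by
      by_contra hcon
      push Not at hcon
      exact hyz (by rw [brauerMap_add, add_mul, hcon.1, hcon.2, add_zero])) (one_mem _) (one_mul 1)
    (by rw [brauerMap_one, one_mul]; exact hx.2.ne_zero)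
  refine ⟨b, hb, hx, ?_⟩
  have hbfix : b ∈ fixedSubalgebra k x.1 := fun g _ => conj_top_of_mem_center hb.mem g
  exact (hx.2.mul_eq_zero_or_eq (brauerMap_mem_center le_top hb.mem)
    (by rw [← brauerMap_mul hx.1 hbfix hbfix, hb.idem])).resolve_left hne

theorem IsBlockBrauerPair.block_unique {b b' : k[G]} (hb : IsBlockIdempotent (⊤ : Subgroup G) b)
    (hb' : IsBlockIdempotent (⊤ : Subgroup G) b') {x : Subgroup G × k[G]}
    (hx : IsBlockBrauerPair p b x) (hx' : IsBlockBrauerPair p b' x) : b = b' := by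
  refine hb.eq_of_mul_ne_zero hb' fun h0 => hx.1.2.ne_zero ?_
  rw [← hx.2, ← hx'.2, ← mul_assoc, ← brauerMap_mul hx.1.1
    (fun g _ => conj_top_of_mem_center hb.mem g) (fun g _ => conj_top_of_mem_center hb'.mem g), h0,
    brauerMap_zero, zero_mul]

end BrauerPairs

/-- The set `G` with the conjugation action of `G`. -/
@[ext] structure ConjSet (G : Type*) where
  /-- The underlying element of `G`. -/
  val : G

instance {G : Type*} [Group G] : MulAction G (ConjSet G) where
  smul g x := ⟨g * x.val * g⁻¹⟩
  one_smul x := ConjSet.ext (by change 1 * x.val * 1⁻¹ = x.val; simp)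
  mul_smul g h x := ConjSet.ext (by
    change g * h * x.val * (g * h)⁻¹ = g * (h * x.val * h⁻¹) * g⁻¹
    group)

/-- `ConjSet G` is a copy of `G`. -/
def ConjSet.equiv (G : Type*) : G ≃ ConjSet G := ⟨ConjSet.mk, ConjSet.val, fun _ => rfl, fun _ => rfl⟩

/-! ### Blocks as relative traces, and conjugacy of maximal Brauer pairs. -/

section Traces

variable {k : Type*} [Field k] {G : Type*} [Group G]

/-- A family of elements of `kG` indexed by a `G`-set is equivariant. -/
def IsEquivariant {X : Type*} [MulAction G X] (u : X → k[G]) : Prop :=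
  ∀ (g : G) (x : X), u (g • x) = conj k g (u x)

theorem mem_center_top_iff {a : k[G]} :
    a ∈ centerSubgroupAlgebra k (⊤ : Subgroup G) ↔ ∀ x, conj k x a = a := by
  rw [mem_centerSubgroupAlgebra_iff]
  constructor
  · exact fun h x => h.2 x trivial
  · exact fun h => ⟨mem_subgroupAlgebra_iff.mpr fun _ hg => absurd trivial hg, fun x _ => h x⟩

theorem mul_comm_of_mem_center_top {z : k[G]} (hz : z ∈ centerSubgroupAlgebra k (⊤ : Subgroup G))
    (a : k[G]) : a * z = z * a :=
  mul_comm_of_mem_center hz (mem_subgroupAlgebra_iff.mpr fun _ hg => absurd trivial hg)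

theorem IsEquivariant.mul_center {X : Type*} [MulAction G X] {u : X → k[G]} (hu : IsEquivariant u)
    {w : k[G]} (hw : w ∈ centerSubgroupAlgebra k (⊤ : Subgroup G)) :
    IsEquivariant fun x => u x * w := by
  intro g x
  rw [map_mul, ← hu, conj_top_of_mem_center hw]

theorem IsEquivariant.sum_mem_center {X : Type*} [MulAction G X] {u : X → k[G]}
    (hu : IsEquivariant u) (s : Finset X) (hs : ∀ (g : G), ∀ x ∈ s, g • x ∈ s) :
    ∑ x ∈ s, u x ∈ centerSubgroupAlgebra k (⊤ : Subgroup G) := by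
  rw [mem_center_top_iff]
  intro g
  rw [map_sum]
  refine Finset.sum_bij (fun x _ => g • x) (fun x hx => hs g x hx)
    (fun x _ y _ h => MulAction.injective g h) (fun y hy => ⟨g⁻¹ • y, hs _ _ hy, ?_⟩)
    (fun x _ => (hu g x).symm)
  rw [smul_inv_smul]

/-- The sum of this family over `G ⧸ D` is the relative trace of `a` from `D` to `G`, with no choice
of coset representatives. -/
theorem exists_isEquivariant_of_mem_fixed {D : Subgroup G} {a : k[G]}
    (ha : a ∈ fixedSubalgebra k D) :
    ∃ u : G ⧸ D → k[G], IsEquivariant u ∧ ∀ g : G, u g = conj k g a := by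
  refine ⟨Quotient.lift (fun g => conj k g a) ?_, ?_, fun _ => rfl⟩
  · intro x y hxy
    have hxy' : x⁻¹ * y ∈ D := QuotientGroup.leftRel_apply.mp hxy
    change conj k x a = conj k y a
    conv_lhs => rw [← ha _ hxy']
    rw [← conj_mul_apply, mul_inv_cancel_left]
  · intro g q
    induction q using QuotientGroup.induction_on with
    | H x => exact conj_mul_apply g x a

theorem IsEquivariant.apply_mk {D : Subgroup G} {u : G ⧸ D → k[G]} (hu : IsEquivariant u) (g : G) :
    u g = conj k g (u (1 : G)) := by
  rw [← hu]
  exact congrArg (fun x : G => u x) (mul_one g).symm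

theorem IsEquivariant.apply_one_mem {D : Subgroup G} {u : G ⧸ D → k[G]} (hu : IsEquivariant u) :
    u (1 : G) ∈ fixedSubalgebra k D := by
  intro x hx
  rw [← hu.apply_mk]
  congr 1
  exact QuotientGroup.eq.mpr (by simpa using hx)

variable [Finite G] {p : ℕ} {b : k[G]}

/-- The orbit sums are central with total `b`, so by primitivity one of them becomes `b` after
multiplication by a central `w`. A sum over an orbit is a trace from the stabilizer of any of its
points. -/
theorem IsBlockIdempotent.exists_orbit_sum_eq (hb : IsBlockIdempotent (⊤ : Subgroup G) b)
    {X : Type*} [Fintype X] [MulAction G X] {u : X → k[G]} (hu : IsEquivariant u)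
    (hsum : ∑ x, u x = b) : ∃ x₀ : X, ∀ x ∈ MulAction.orbit G x₀, u x ≠ 0 ∧
      ∃ v : G ⧸ MulAction.stabilizer G x → k[G], IsEquivariant v ∧
        ∀ [Fintype (G ⧸ MulAction.stabilizer G x)], ∑ q, v q = b := by
  classical
  have hsum' := hsum
  rw [← Finset.sum_fiberwise (g := fun x => (⟦x⟧ : MulAction.orbitRel.Quotient G X))] at hsum'
  obtain ⟨ω, -, w, hw, hwb⟩ := IsPrimitiveIdempotent.exists_mul_eq_of_sum_eq
    (center_mul_comm ⊤) hb _ _ (fun ω _ => hu.sum_mem_center _ (by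
      intro g x hx
      simp only [Finset.mem_filter, Finset.mem_univ, true_and] at hx ⊢
      rw [← hx]
      exact Quotient.sound ⟨g, rfl⟩)) hsum'
  obtain ⟨x₀, rfl⟩ := Quotient.exists_rep ω
  refine ⟨x₀, fun x hx => ?_⟩
  have hx' : (⟦x₀⟧ : MulAction.orbitRel.Quotient G X) = ⟦x⟧ := (Quotient.sound hx).symm
  rw [hx'] at hwb
  constructor
  · intro h0
    apply hb.ne_zero
    rw [← hwb, Finset.sum_eq_zero, zero_mul]
    intro y hy
    obtain ⟨g, rfl⟩ := Quotient.exact (Finset.mem_filter.mp hy).2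
    change u (g • x) = 0
    rw [hu, h0, map_zero]
  · refine ⟨fun q => u (MulAction.ofQuotientStabilizer G x q) * w, ?_, ?_⟩
    · intro g q
      change u (MulAction.ofQuotientStabilizer G x (g • q)) * w = _
      rw [map_mul, ← hu, conj_top_of_mem_center hw, MulAction.ofQuotientStabilizer_smul]
    · intro _
      rw [← Finset.sum_mul, ← hwb]
      congr 1
      refine Finset.sum_bij (fun q _ => MulAction.ofQuotientStabilizer G x q) ?_ ?_ ?_ ?_
      · intro q _
        simp only [Finset.mem_filter, Finset.mem_univ, true_and]
        exact Quotient.sound (MulAction.ofQuotientStabilizer_mem_orbit G x q)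
      · exact fun q _ q' _ h => MulAction.injective_ofQuotientStabilizer G x h
      · intro y hy
        obtain ⟨g, rfl⟩ := Quotient.exact (Finset.mem_filter.mp hy).2
        exact ⟨g, Finset.mem_univ _, rfl⟩
      · exact fun _ _ => rfl

/-- `b` is a relative trace from the `p`-subgroup `D`. -/
def IsTraceFrom (p : ℕ) (b : k[G]) (D : Subgroup G) : Prop :=
  IsPGroup p D ∧ ∃ u : G ⧸ D → k[G], IsEquivariant u ∧ ∀ [Fintype (G ⧸ D)], ∑ q, u q = b

/-- Expand `j` in the basis `G`: the trace becomes a sum over the `G`-set of pairs of a coset and a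
group element, where `(1, x)` has stabilizer `C_D(x)`. If this were `D`, then `x` would centralize
`D` and the coefficient of `j` at `x` would vanish because `Br_D(j) = 0`. -/
theorem exists_isTraceFrom_lt {D : Subgroup G} (hD : IsPGroup p D)
    (hb : IsBlockIdempotent (⊤ : Subgroup G) b) {a j : k[G]} (ha : a ∈ fixedSubalgebra k D)
    (hj : j ∈ fixedSubalgebra k D) (hj0 : brauerMap k D j = 0) {u : G ⧸ D → k[G]}
    (hu : IsEquivariant u) (hu1 : u (1 : G) = a * j) [Fintype (G ⧸ D)] (hsum : ∑ q, u q = b) :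
    ∃ T, T < D ∧ IsTraceFrom p b T := by
  classical
  have : Fintype G := Fintype.ofFinite G
  have : Fintype (ConjSet G) := Fintype.ofEquiv G (ConjSet.equiv G)
  obtain ⟨v, hv, hva⟩ := exists_isEquivariant_of_mem_fixed ha
  obtain ⟨t, ht, htj⟩ := exists_isEquivariant_of_mem_fixed hj
  have huq : ∀ q, u q = v q * t q := by
    intro q
    induction q using QuotientGroup.induction_on with
    | H x => rw [hu.apply_mk, hu1, map_mul, hva, htj]
  let V : (G ⧸ D) × ConjSet G → k[G] := fun y =>
    v y.1 * MonoidAlgebra.single y.2.val ((t y.1).coeff y.2.val)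
  have hVdef : ∀ q (h : G), V (q, ⟨h⟩) = v q * MonoidAlgebra.single h ((t q).coeff h) :=
    fun _ _ => rfl
  have hV : IsEquivariant V := by
    rintro g ⟨q, ⟨h⟩⟩
    change V (g • q, ⟨g * h * g⁻¹⟩) = _
    rw [hVdef, hVdef, map_mul (conj k g) (v q), hv, ht]
    congr 1
    rw [coeff_conj]
    have : g⁻¹ * (g * h * g⁻¹) * g = h := by group
    rw [this]
    simp [conj]
  have hVsum : ∑ y, V y = b := by
    rw [Fintype.sum_prod_type, ← hsum]
    refine Finset.sum_congr rfl fun q _ => ?_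
    rw [huq, ← (ConjSet.equiv G).sum_comp]
    change ∑ h, v q * MonoidAlgebra.single h ((t q).coeff h) = _
    rw [← Finset.mul_sum]
    congr 1
    conv_rhs => rw [← MonoidAlgebra.sum_coeff_single (t q)]
    exact (Finsupp.sum_fintype (t q).coeff _ (by simp)).symm
  obtain ⟨x₀, hx₀⟩ := hb.exists_orbit_sum_eq hV hVsum
  obtain ⟨⟨x⟩, hx⟩ : ∃ h : ConjSet G, (((1 : G) : G ⧸ D), h) ∈ MulAction.orbit G x₀ := by
    obtain ⟨q, h⟩ := x₀
    obtain ⟨g, rfl⟩ := QuotientGroup.mk_surjective q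
    refine ⟨g⁻¹ • h, g⁻¹, ?_⟩
    refine Prod.ext ?_ rfl
    change ((g⁻¹ * g : G) : G ⧸ D) = _
    rw [inv_mul_cancel]
  obtain ⟨hne, hex⟩ := hx₀ _ hx
  have hstab : ∀ g, g ∈ MulAction.stabilizer G ((((1 : G) : G ⧸ D), ⟨x⟩) : (G ⧸ D) × ConjSet G) →
      g ∈ D ∧ (g * x * g⁻¹ : G) = x := by
    intro g hg
    have h1 := congrArg Prod.fst (MulAction.mem_stabilizer_iff.mp hg)
    have h2 := congrArg (fun y => y.2.val) (MulAction.mem_stabilizer_iff.mp hg)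
    refine ⟨?_, h2⟩
    have h3 : ((1 : G) : G ⧸ D) = ((g * 1 : G) : G ⧸ D) := h1.symm
    simpa using QuotientGroup.eq.mp h3
  have hle : MulAction.stabilizer G ((((1 : G) : G ⧸ D), ⟨x⟩) : (G ⧸ D) × ConjSet G) ≤ D :=
    fun g hg => (hstab g hg).1
  refine ⟨_, lt_of_le_not_ge hle fun hge => hne ?_, hD.to_le hle, hex⟩
  rw [hVdef, htj, conj_one_apply]
  have hxC : (x : G) ∈ Subgroup.centralizer (D : Set G) := by
    rw [Subgroup.mem_centralizer_iff]
    exact fun g hg => mul_inv_eq_iff_eq_mul.mp (hstab g (hge hg)).2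
  have h0 := congrArg (fun c : k[G] => c.coeff x) hj0
  simp only [coeff_brauerMap, MonoidAlgebra.coeff_zero, Finsupp.coe_zero, Pi.zero_apply] at h0
  rw [if_pos hxC] at h0
  rw [h0, MonoidAlgebra.single_zero, mul_zero]

variable [Fact p.Prime] [CharP k p]

/-- The index of a Sylow `p`-subgroup is invertible in `k`, so `b` is the trace of a scalar multiple
of itself. -/
theorem exists_isTraceFrom (hb : b ∈ centerSubgroupAlgebra k (⊤ : Subgroup G)) :
    ∃ D : Subgroup G, IsTraceFrom p b D := by
  obtain ⟨D⟩ : Nonempty (Sylow p G) := inferInstance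
  refine ⟨D, D.isPGroup', fun _ => ((D : Subgroup G).index : k)⁻¹ • b, ?_, ?_⟩
  · intro g x
    rw [map_smul, conj_top_of_mem_center hb]
  · intro _
    rw [Finset.sum_const, Finset.card_univ, ← Nat.card_eq_fintype_card, ← Subgroup.index,
      ← Nat.cast_smul_eq_nsmul k, smul_smul, mul_inv_cancel₀, one_smul]
    rw [Ne, CharP.cast_eq_zero_iff k p]
    exact D.not_dvd_index

/-- There are a `p`-subgroup `D` and a primitive idempotent `j` of `(kG)^D` with `Br_D(j) ≠ 0`
such that the block idempotent `b` is the relative trace of an element of `(kG)^D j`. -/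
theorem IsBlockIdempotent.exists_trace_eq (p : ℕ) [Fact p.Prime] [CharP k p]
    (hb : IsBlockIdempotent (⊤ : Subgroup G) b) :
    ∃ (D : Subgroup G) (j : k[G]) (u : G ⧸ D → k[G]), IsPGroup p D ∧
      IsPrimitiveIdempotent (fixedSubalgebra k D) j ∧ brauerMap k D j ≠ 0 ∧ IsEquivariant u ∧
      u (1 : G) * j = u (1 : G) ∧ ∀ [Fintype (G ⧸ D)], ∑ q, u q = b := by
  -- `D` is minimal among the `p`-subgroups from which `b` is a trace. This is what later excludes
  -- `Br_D(j) = 0`.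
  obtain ⟨D, ⟨hD, v, hv, hvb⟩, hmin⟩ := wellFounded_lt.has_min {D : Subgroup G | IsTraceFrom p b D}
    (exists_isTraceFrom hb.mem)
  have : Fintype (G ⧸ D) := Fintype.ofFinite _
  let τ : k[G] →+ k[G] := ∑ q : G ⧸ D, ((conj k q.out).toRingEquiv.toRingHom : k[G] →+ k[G])
  have hτ : ∀ {u : G ⧸ D → k[G]}, IsEquivariant u → τ (u (1 : G)) = ∑ q, u q := by
    intro u hu
    rw [AddMonoidHom.finsetSum_apply]
    refine Finset.sum_congr rfl fun q _ => ?_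
    conv_rhs => rw [← QuotientGroup.out_eq' q, hu.apply_mk]
    rfl
  have hv1 := hv.apply_one_mem
  have hτmem : ∀ a ∈ fixedSubalgebra k D, τ a ∈ centerSubgroupAlgebra k (⊤ : Subgroup G) := by
    intro a ha
    obtain ⟨u, hu, hua⟩ := exists_isEquivariant_of_mem_fixed ha
    have : a = u (1 : G) := by rw [hua, conj_one_apply]
    rw [this, hτ hu]
    exact hu.sum_mem_center _ fun _ _ _ => Finset.mem_univ _
  -- Non-nilpotency of a central element passes from a sum to one of its terms, so it selects a
  -- primitive component `j` of `1` whose trace is still invertible in the block `b`.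
  obtain ⟨j, hj, -, -, hjn⟩ := exists_isPrimitiveIdempotent (S := fixedSubalgebra k D) (i := 1)
    (fun x => ¬ IsNilpotent (τ (v (1 : G) * x) * b)) (by simp) (by
      intro x hx y hy hxy
      by_contra hcon
      push Not at hcon
      apply hxy
      rw [mul_add, map_add, add_mul]
      refine Commute.isNilpotent_add ?_ hcon.1 hcon.2
      exact center_mul_comm ⊤ _ (mul_mem (hτmem _ (mul_mem hv1 hx)) hb.mem) _
        (mul_mem (hτmem _ (mul_mem hv1 hy)) hb.mem)) (one_mem _) (one_mul 1)
    (by rw [mul_one, hτ hv, hvb, hb.idem]; exact hb.not_isNilpotent)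
  obtain ⟨w, hw, hwb⟩ := (hb.isNilpotent_or_exists_mul_eq
    (mul_mem (hτmem _ (mul_mem hv1 hj.mem)) hb.mem)
    (by rw [← mul_assoc, ← mul_comm_of_mem_center_top hb.mem, mul_assoc, hb.idem])
    (by rw [mul_assoc, hb.idem])).resolve_left hjn
  obtain ⟨u, hu, huv⟩ := exists_isEquivariant_of_mem_fixed (mul_mem hv1 hj.mem)
  have hbw := mul_mem hb.mem hw
  have hsum : ∑ q, u q * (b * w) = b := by
    conv_rhs => rw [← hwb]
    rw [← Finset.sum_mul, ← hτ hu, huv, conj_one_apply, ← mul_assoc, mul_comm_of_mem_center_top hw]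
  have hu1 : u (1 : G) * (b * w) = v (1 : G) * (b * w) * j := by
    rw [huv, conj_one_apply, mul_assoc, mul_comm_of_mem_center_top hbw j, ← mul_assoc]
  refine ⟨D, j, fun q => u q * (b * w), hD, hj, ?_, hu.mul_center hbw, ?_, ?_⟩
  · intro h0
    obtain ⟨T, hT, hTb⟩ := exists_isTraceFrom_lt hD hb
      (mul_mem hv1 fun x _ => conj_top_of_mem_center hbw x) hj.mem h0 (hu.mul_center hbw) hu1 hsum
    exact hmin T hTb hT
  · change u (1 : G) * (b * w) * j = u (1 : G) * (b * w)
    rw [hu1, mul_assoc, hj.idem]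
  · intro _
    convert hsum

/-- Apply `Br_Q` to `b` written as a trace from `D`: only cosets `xD` fixed by `Q` remain, that is,
those with `Q ≤ xDx⁻¹`. A term not killed by `f` makes `f` meet `Br_Q(ˣj)`, which identifies `f`
with the block below `ˣ(D, e)`. -/
theorem IsBlockIdempotent.exists_defect_pair (p : ℕ) [Fact p.Prime] [CharP k p]
    (hb : IsBlockIdempotent (⊤ : Subgroup G) b) :
    ∃ y : Subgroup G × k[G], IsBrauerPair p y ∧
      ∀ z, IsBlockBrauerPair p b z → ∃ x, BrauerLE z (conjPair x y) := by
  classical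
  obtain ⟨D, j, u, hD, hj, hjD, hu, huj, hsum⟩ := hb.exists_trace_eq p
  have : Fintype (G ⧸ D) := Fintype.ofFinite _
  obtain ⟨e, he, -, -, hne⟩ := exists_isPrimitiveIdempotent
    (S := centerSubgroupAlgebra k (Subgroup.centralizer (D : Set G))) (i := 1)
    (fun z => brauerMap k D j * z ≠ 0) (by simp)
    (fun y _ z _ hyz => by
      by_contra hcon
      push Not at hcon
      exact hyz (by rw [mul_add, hcon.1, hcon.2, add_zero])) (one_mem _) (one_mul 1)
    (by rwa [mul_one])
  have hDe : IsBrauerPair p (D, e) := ⟨hD, he⟩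
  have hjDe := hDe.isAssociated hj hne
  refine ⟨(D, e), hDe, ?_⟩
  rintro ⟨Q, f⟩ hQ
  have hpQ : IsPGroup p Q := hQ.1.1
  have h1 := brauerMap_sum_eq hpQ u (fun h q => hu h q)
  rw [hsum] at h1
  have h2 : ∑ q with q ∈ MulAction.fixedPoints Q (G ⧸ D), brauerMap k Q (u q) * f ≠ 0 := by
    rw [← Finset.sum_mul, ← h1, show brauerMap k Q b * f = f from hQ.2]
    exact hQ.1.2.ne_zero
  obtain ⟨q, hq, hqf⟩ := Finset.exists_ne_zero_of_sum_ne_zero h2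
  obtain ⟨x, rfl⟩ := QuotientGroup.mk_surjective q
  have hfix := (Finset.mem_filter.mp hq).2
  refine ⟨x, ?_⟩
  have hQx : Q ≤ D.map (MulAut.conj x).toMonoidHom := by
    intro h hh
    rw [Subgroup.mem_map_equiv, MulAut.conj_symm_apply]
    have h3 : ((h * x : G) : G ⧸ D) = (x : G ⧸ D) := hfix ⟨h, hh⟩
    have h4 := QuotientGroup.eq.mp h3.symm
    rwa [← mul_assoc] at h4
  have huQ : u x ∈ fixedSubalgebra k Q := by
    intro h hh
    rw [← hu]
    exact congrArg u (hfix ⟨h, hh⟩)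
  have hxj : conj k x j ∈ fixedSubalgebra k Q :=
    fixedSubalgebra_anti hQx (conj_mem_fixedSubalgebra_iff.mpr hj.mem)
  have hux : u x * conj k x j = u x := by
    rw [hu.apply_mk, ← map_mul, huj]
  obtain ⟨f', hf', hle⟩ := (hDe.map_conj x).exists_brauerLE hQx
  suffices f = f' by rwa [this]
  have hass := hle.2 _ (hj.map_conj x) (hjDe.map_conj x)
  refine hQ.1.2.eq_of_mul_ne_zero hf'.2 fun h0 => hqf ?_
  rw [← hux, brauerMap_mul hpQ huQ hxj, mul_assoc, hQ.1.mul_comm, ← hass.1]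
  change _ * (f * (f' * _)) = 0
  rw [← mul_assoc f, show f * f' = 0 from h0, zero_mul, mul_zero]

/-- Every `(kG, b)`-Brauer pair is contained in a conjugate of any given maximal one. -/
theorem IsMaximalBrauerPair.exists_brauerLE_conjPair (hb : IsBlockIdempotent (⊤ : Subgroup G) b)
    {y z : Subgroup G × k[G]} (hy : IsMaximalBrauerPair p b y) (hz : IsBlockBrauerPair p b z) :
    ∃ x, BrauerLE z (conjPair x y) := by
  obtain ⟨d, hd, hle⟩ := hb.exists_defect_pair p
  obtain ⟨g, hg⟩ := hle y hy.1
  obtain ⟨x, hx⟩ := hle z hz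
  have hdg := hd.map_conj g
  -- The defect pair was not shown to belong to `b`. Its conjugate containing `y` belongs to some
  -- block, which is that of `y`, so maximality makes this conjugate equal to `y`.
  obtain ⟨b', hb', hdb'⟩ := hdg.exists_isBlockBrauerPair
  have hyb' := IsBlockBrauerPair.of_brauerLE hb' hy.1.1 hdb' hg
  have hbb := IsBlockBrauerPair.block_unique hb hb' hy.1 hyb'
  subst hbb
  have heq := hy.2 _ hdb' hg
  refine ⟨x * g⁻¹, ?_⟩
  rw [← heq, ← conjPair_mul, inv_mul_cancel_right]
  exact hx

end Traces

/-! ### Field homomorphisms applied to coefficients: Galois action, scalar extension, Frobenius. -/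

section CoefficientMaps

variable {k k' G : Type*} [Field k] [Field k'] [Group G] (τ : k →+* k')

theorem mapRingHom_injective : Function.Injective (MonoidAlgebra.mapRingHom G τ) := by
  intro a b h
  ext g
  apply τ.injective
  rw [← MonoidAlgebra.coeff_mapRingHom, h, MonoidAlgebra.coeff_mapRingHom]

theorem mapRingHom_brauerMap (P : Subgroup G) (a : k[G]) :
    MonoidAlgebra.mapRingHom G τ (brauerMap k P a) =
      brauerMap k' P (MonoidAlgebra.mapRingHom G τ a) := by
  classical
  ext g
  simp only [MonoidAlgebra.coeff_mapRingHom, coeff_brauerMap]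
  split_ifs <;> simp

theorem mapRingHom_conj (x : G) (a : k[G]) :
    MonoidAlgebra.mapRingHom G τ (conj k x a) = conj k' x (MonoidAlgebra.mapRingHom G τ a) := by
  ext g
  simp

theorem mapRingHom_mem_subgroupAlgebra_iff {H : Subgroup G} {a : k[G]} :
    MonoidAlgebra.mapRingHom G τ a ∈ subgroupAlgebra k' H ↔ a ∈ subgroupAlgebra k H := by
  simp [mem_subgroupAlgebra_iff]

theorem mapRingHom_mem_fixedSubalgebra_iff {P : Subgroup G} {a : k[G]} :
    MonoidAlgebra.mapRingHom G τ a ∈ fixedSubalgebra k' P ↔ a ∈ fixedSubalgebra k P := by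
  simp only [mem_fixedSubalgebra_iff, ← mapRingHom_conj, (mapRingHom_injective τ).eq_iff]

theorem mapRingHom_mem_center_iff {H : Subgroup G} {a : k[G]} :
    MonoidAlgebra.mapRingHom G τ a ∈ centerSubgroupAlgebra k' H ↔
      a ∈ centerSubgroupAlgebra k H := by
  simp only [mem_centerSubgroupAlgebra_iff, ← mapRingHom_conj, (mapRingHom_injective τ).eq_iff,
    mapRingHom_mem_subgroupAlgebra_iff]

end CoefficientMaps

/-! ### Galois descent of blocks and Brauer pairs. -/

section GaloisAction

variable {K L G : Type*} [Field K] [Field L] [Algebra K L] [Group G]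

@[simp] theorem coeff_galoisAct (γ : L ≃ₐ[K] L) (a : L[G]) (g : G) :
    (galoisAct γ a).coeff g = γ (a.coeff g) := by
  simp [galoisAct]

theorem galoisAct_mul (γ δ : L ≃ₐ[K] L) (a : L[G]) :
    galoisAct (γ * δ) a = galoisAct γ (galoisAct δ a) := by
  ext g; simp

theorem galoisAct_one (a : L[G]) : galoisAct (1 : L ≃ₐ[K] L) a = a := by
  ext g; simp

/-- The action of a Galois automorphism as a ring automorphism of the group algebra. -/
noncomputable def galoisEquiv (G : Type*) [Group G] (γ : L ≃ₐ[K] L) : L[G] ≃+* L[G] :=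
  { galoisAct γ with
    invFun := galoisAct γ⁻¹
    left_inv := fun a => by
      change galoisAct γ⁻¹ (galoisAct γ a) = a
      rw [← galoisAct_mul, inv_mul_cancel, galoisAct_one]
    right_inv := fun a => by
      change galoisAct γ (galoisAct γ⁻¹ a) = a
      rw [← galoisAct_mul, mul_inv_cancel, galoisAct_one] }

theorem galoisAct_conj (γ : L ≃ₐ[K] L) (x : G) (a : L[G]) :
    galoisAct γ (conj L x a) = conj L x (galoisAct γ a) := mapRingHom_conj _ x a

theorem galoisAct_brauerMap (γ : L ≃ₐ[K] L) (P : Subgroup G) (a : L[G]) :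
    galoisAct γ (brauerMap L P a) = brauerMap L P (galoisAct γ a) := mapRingHom_brauerMap _ P a

theorem galoisAct_scalarExt (γ : L ≃ₐ[K] L) (c : K[G]) :
    galoisAct γ (scalarExt K L G c) = scalarExt K L G c := by
  ext g; simp [scalarExt]

theorem scalarExt_injective : Function.Injective (scalarExt K L G) := mapRingHom_injective _

/-- The action of a Galois automorphism on pairs. -/
noncomputable def galoisPair (γ : L ≃ₐ[K] L) (y : Subgroup G × L[G]) : Subgroup G × L[G] :=
  (y.1, galoisAct γ y.2)

theorem galoisPair_conjPair (γ : L ≃ₐ[K] L) (x : G) (y : Subgroup G × L[G]) :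
    galoisPair γ (conjPair x y) = conjPair x (galoisPair γ y) :=
  Prod.ext rfl (galoisAct_conj γ x y.2)

theorem galoisPair_inv_galoisPair (γ : L ≃ₐ[K] L) (y : Subgroup G × L[G]) :
    galoisPair γ⁻¹ (galoisPair γ y) = y := by
  refine Prod.ext rfl ?_
  change galoisAct γ⁻¹ (galoisAct γ y.2) = y.2
  rw [← galoisAct_mul, inv_mul_cancel, galoisAct_one]

theorem IsBlockIdempotent.galoisAct {H : Subgroup G} {b : L[G]} (hb : IsBlockIdempotent H b)
    (γ : L ≃ₐ[K] L) : IsBlockIdempotent H (galoisAct γ b) :=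
  IsPrimitiveIdempotent.map (galoisEquiv G γ) (fun _ => mapRingHom_mem_center_iff _) hb

theorem IsBrauerPair.galoisPair {p : ℕ} {y : Subgroup G × L[G]} (h : IsBrauerPair p y)
    (γ : L ≃ₐ[K] L) : IsBrauerPair p (galoisPair γ y) := ⟨h.1, h.2.galoisAct γ⟩

theorem IsAssociated.galoisPair {i : L[G]} {y : Subgroup G × L[G]} (h : IsAssociated i y)
    (γ : L ≃ₐ[K] L) : IsAssociated (galoisAct γ i) (galoisPair γ y) := by
  unfold IsAssociated BlockFusion.galoisPair
  rw [← galoisAct_brauerMap, ← map_mul, h.1]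
  exact ⟨rfl, fun h0 => h.2 ((galoisEquiv G γ).injective (h0.trans (map_zero _).symm))⟩

theorem BrauerLE.galoisPair {x y : Subgroup G × L[G]} (h : BrauerLE x y) (γ : L ≃ₐ[K] L) :
    BrauerLE (galoisPair γ x) (galoisPair γ y) := by
  refine ⟨h.1, fun i hi hiy => ?_⟩
  have hi' : IsPrimitiveIdempotent (fixedSubalgebra L y.1) (galoisAct γ⁻¹ i) :=
    IsPrimitiveIdempotent.map (galoisEquiv G γ⁻¹)
      (fun _ => mapRingHom_mem_fixedSubalgebra_iff _) hi
  have hiy' := hiy.galoisPair γ⁻¹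
  rw [galoisPair_inv_galoisPair] at hiy'
  have := (h.2 _ hi' hiy').galoisPair γ
  rwa [← galoisAct_mul, mul_inv_cancel, galoisAct_one] at this

variable [FiniteDimensional K L]

theorem conjugateSum_mul {H : Subgroup G} {b : L[G]} (hb : IsBlockIdempotent H b) :
    conjugateSum K b * b = b := by
  classical
  rw [conjugateSum, Finset.sum_mul, Finset.sum_eq_single b]
  · exact hb.idem
  · intro c hc hne
    obtain ⟨γ, -, rfl⟩ := Finset.mem_image.mp hc
    exact (IsPrimitiveIdempotent.mul_eq_zero_or_eq_of_comm (center_mul_comm H)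
      (hb.galoisAct γ) hb).resolve_right hne
  · intro h
    exact absurd (Finset.mem_image.mpr ⟨1, Finset.mem_univ _, galoisAct_one b⟩) h

theorem mul_conjugateSum_of_scalar {b : L[G]} {c : K[G]} :
    scalarExt K L G c * b = b → scalarExt K L G c * conjugateSum K b = conjugateSum K b := by
  classical
  intro h
  rw [conjugateSum, Finset.mul_sum]
  refine Finset.sum_congr rfl fun d hd => ?_
  obtain ⟨γ, -, rfl⟩ := Finset.mem_image.mp hd
  conv_lhs => rw [← galoisAct_scalarExt γ, ← map_mul, h]

theorem mul_conjugateSum_eq_zero {b : L[G]} {c : K[G]} (h : scalarExt K L G c * b = 0) :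
    scalarExt K L G c * conjugateSum K b = 0 := by
  classical
  rw [conjugateSum, Finset.mul_sum]
  refine Finset.sum_eq_zero fun d hd => ?_
  obtain ⟨γ, -, rfl⟩ := Finset.mem_image.mp hd
  rw [← galoisAct_scalarExt γ, ← map_mul, h, map_zero]

variable [IsGalois K L]

theorem scalarExt_tilde_mul {H : Subgroup G} {b : L[G]} (hb : IsBlockIdempotent H b) :
    scalarExt K L G (tilde K b) * b = b := by
  rw [scalarExt_tilde, conjugateSum_mul hb]

theorem IsBlockIdempotent.tilde {H : Subgroup G} {b : L[G]} (hb : IsBlockIdempotent H b) :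
    IsBlockIdempotent H (tilde K b) := by
  classical
  have hinj := scalarExt_injective (K := K) (L := L) (G := G)
  have hmem : ∀ c : K[G], scalarExt K L G c ∈ centerSubgroupAlgebra L H ↔
      c ∈ centerSubgroupAlgebra K H := fun _ => mapRingHom_mem_center_iff _
  refine ⟨?_, ?_, ?_, ?_⟩
  · rw [← hmem, scalarExt_tilde, conjugateSum]
    refine sum_mem fun c hc => ?_
    obtain ⟨γ, -, rfl⟩ := Finset.mem_image.mp hc
    exact (hb.galoisAct γ).mem
  · apply hinj
    have h := mul_conjugateSum_of_scalar (scalarExt_tilde_mul (K := K) hb)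
    rw [map_mul]
    rwa [← scalarExt_tilde] at h
  · intro h0
    have := scalarExt_tilde_mul (K := K) hb
    rw [h0, map_zero, zero_mul] at this
    exact hb.ne_zero this.symm
  · intro c hc d hd hcc hdd hcd _ hsum
    -- Having coefficients in `K`, `c` treats all conjugates of `b` alike, so it kills or fixes the
    -- whole orbit sum.
    rcases IsPrimitiveIdempotent.mul_eq_zero_or_eq hb ((hmem c).mpr hc)
      (by rw [← map_mul, hcc]) (center_mul_comm H _ ((hmem c).mpr hc) _ hb.mem) with h | h
    · left
      apply hinj
      have h1 := mul_conjugateSum_eq_zero h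
      rw [← scalarExt_tilde, ← map_mul, ← hsum, mul_add, hcc, hcd, add_zero] at h1
      rw [h1, map_zero]
    · right
      apply hinj
      have h1 := mul_conjugateSum_of_scalar h
      rw [← scalarExt_tilde, ← map_mul, ← hsum, mul_add, hcc, hcd, add_zero, map_add,
        left_eq_add] at h1
      rw [h1, map_zero]

theorem IsBlockIdempotent.eq_tilde {H : Subgroup G} {b : L[G]} {c : K[G]}
    (hb : IsBlockIdempotent H b) (hc : IsBlockIdempotent H c) (h : scalarExt K L G c * b ≠ 0) :
    c = BlockFusion.tilde K b := by
  refine hc.eq_of_mul_ne_zero hb.tilde fun h0 => h ?_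
  conv_lhs => rw [← scalarExt_tilde_mul (K := K) hb]
  rw [← mul_assoc, ← map_mul, h0, map_zero, zero_mul]

theorem IsBlockIdempotent.exists_eq_tilde [Finite G] {H : Subgroup G} {c : K[G]}
    (hc : IsBlockIdempotent H c) :
    ∃ b : L[G], IsBlockIdempotent H b ∧ BlockFusion.tilde K b = c := by
  obtain ⟨b, hb, h1, -, -⟩ := exists_isPrimitiveIdempotent (S := centerSubgroupAlgebra L H)
    (i := scalarExt K L G c) (fun x => x ≠ 0) (by simp)
    (fun x _ y _ h => by
      by_contra h'
      push Not at h'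
      exact h (by rw [h'.1, h'.2, add_zero])) ((mapRingHom_mem_center_iff _).mpr hc.mem)
    (by rw [← map_mul, hc.idem])
    (fun h0 => hc.ne_zero (scalarExt_injective (h0.trans (map_zero _).symm)))
  exact ⟨b, hb, (IsBlockIdempotent.eq_tilde hb hc (by rw [h1]; exact hb.ne_zero)).symm⟩

theorem IsBlockIdempotent.exists_galoisAct_eq {H : Subgroup G} {b b' : L[G]}
    (hb : IsBlockIdempotent H b) (hb' : IsBlockIdempotent H b')
    (h : BlockFusion.tilde K b = BlockFusion.tilde K b') :
    ∃ γ : L ≃ₐ[K] L, BlockFusion.galoisAct γ b' = b := by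
  classical
  have h1 := scalarExt_tilde_mul (K := K) hb
  rw [h, scalarExt_tilde, conjugateSum, Finset.sum_mul] at h1
  obtain ⟨c, hc, hne⟩ := Finset.exists_ne_zero_of_sum_ne_zero (h1.trans_ne hb.ne_zero)
  obtain ⟨γ, -, rfl⟩ := Finset.mem_image.mp hc
  exact ⟨γ, (hb'.galoisAct γ).eq_of_mul_ne_zero hb hne⟩

theorem IsBlockIdempotent.tilde_galoisAct {H : Subgroup G} {b : L[G]}
    (hb : IsBlockIdempotent H b) (γ : L ≃ₐ[K] L) :
    BlockFusion.tilde K (BlockFusion.galoisAct γ b) = BlockFusion.tilde K b := by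
  symm
  refine (hb.galoisAct γ).eq_tilde hb.tilde ?_
  rw [← galoisAct_scalarExt γ, ← map_mul, scalarExt_tilde_mul hb]
  exact (hb.galoisAct γ).ne_zero

theorem IsBlockIdempotent.tilde_conj {H : Subgroup G} {b : L[G]}
    (hb : IsBlockIdempotent H b) (x : G) :
    BlockFusion.tilde K (conj L x b) = conj K x (BlockFusion.tilde K b) := by
  symm
  refine (hb.map_conj x).eq_tilde (hb.tilde.map_conj x) ?_
  rw [show scalarExt K L G _ = _ from mapRingHom_conj _ _ _, ← map_mul,
    show MonoidAlgebra.mapRingHom G (algebraMap K L) _ * b = b from scalarExt_tilde_mul hb]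
  exact (hb.map_conj x).ne_zero

/-- The pair `(P, ẽ)` attached to `(P, e)`. -/
noncomputable def tildePair (K : Type*) {L G : Type*} [Field K] [Field L] [Algebra K L] [Group G]
    [FiniteDimensional K L] [IsGalois K L] (y : Subgroup G × L[G]) : Subgroup G × K[G] :=
  (y.1, tilde K y.2)

theorem IsBrauerPair.tildePair {p : ℕ} {y : Subgroup G × L[G]} (h : IsBrauerPair p y) :
    IsBrauerPair p (tildePair K y) := ⟨h.1, h.2.tilde⟩

theorem IsBrauerPair.tildePair_conjPair {p : ℕ} {y : Subgroup G × L[G]} (h : IsBrauerPair p y)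
    (x : G) : BlockFusion.tildePair K (conjPair x y) = conjPair x (BlockFusion.tildePair K y) :=
  Prod.ext rfl (h.2.tilde_conj x)

theorem IsBrauerPair.tildePair_galoisPair {p : ℕ} {y : Subgroup G × L[G]} (h : IsBrauerPair p y)
    (γ : L ≃ₐ[K] L) :
    BlockFusion.tildePair K (BlockFusion.galoisPair γ y) = BlockFusion.tildePair K y :=
  Prod.ext rfl (h.2.tilde_galoisAct γ)

theorem IsBrauerPair.exists_eq_tildePair [Finite G] {p : ℕ} {y : Subgroup G × K[G]} (hy : IsBrauerPair p y) :
    ∃ x : Subgroup G × L[G], IsBrauerPair p x ∧ BlockFusion.tildePair K x = y := by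
  obtain ⟨f, hf, hfy⟩ := hy.2.exists_eq_tilde (L := L)
  exact ⟨(y.1, f), ⟨hy.1, hf⟩, Prod.ext rfl hfy⟩

variable [Finite G] {p : ℕ} [Fact p.Prime] [CharP K p]

/-- Let `f'` be the block below `(P, ẽ)` at `Q`, and `i` a primitive idempotent of `(KG)^P`
associated to `(P, ẽ)`. Over `L`, `i` has a primitive component `j` associated to `(P, e)`; both `f`
and `f'` fix `Br_Q(j) ≠ 0`, so `f'` is the orbit sum of `f`. -/
theorem BrauerLE.tildePair [CharP L p] {x y : Subgroup G × L[G]} (hx : IsBrauerPair p x)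
    (hy : IsBrauerPair p y) (h : BrauerLE x y) :
    BrauerLE (tildePair K x) (tildePair K y) := by
  obtain ⟨Q, f⟩ := x
  obtain ⟨P, e⟩ := y
  have hQP : Q ≤ P := h.1
  have hpQ : IsPGroup p Q := hx.1
  obtain ⟨f', hf', hle⟩ := (hy.tildePair (K := K)).exists_brauerLE hQP
  suffices f' = tilde K f by
    rw [this] at hle
    exact hle
  obtain ⟨i, hi, hiP⟩ := (hy.tildePair (K := K)).exists_isAssociated_one
  have hiQ := hle.2 i hi hiP
  have hiP' : tilde K e * brauerMap K P i = brauerMap K P i := hiP.1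
  have hiQ' : f' * brauerMap K Q i = brauerMap K Q i := hiQ.1
  have hext : ∀ (R : Subgroup G) (a : K[G]),
      scalarExt K L G (brauerMap K R a) = brauerMap L R (scalarExt K L G a) :=
    fun R a => mapRingHom_brauerMap _ R a
  have hI : scalarExt K L G i ∈ fixedSubalgebra L P :=
    (mapRingHom_mem_fixedSubalgebra_iff _).mpr hi.mem
  have hne : brauerMap L P (scalarExt K L G i) * e ≠ 0 := by
    intro h0
    rw [← hext] at h0
    have h1 := mul_conjugateSum_eq_zero h0
    rw [← scalarExt_tilde, ← map_mul, (hy.tildePair (K := K)).mul_comm] at h1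
    change scalarExt K L G (tilde K e * brauerMap K P i) = 0 at h1
    rw [hiP'] at h1
    exact hiP.2 (scalarExt_injective (h1.trans (map_zero _).symm))
  obtain ⟨j, hj, h1, -, hjP⟩ := hy.exists_isAssociated hI (by rw [← map_mul, hi.idem]) hne
  have hjQ := h.2 j hj hjP
  have hjQ' : f * brauerMap L Q j = brauerMap L Q j := hjQ.1
  refine IsBlockIdempotent.eq_tilde hx.2 hf'.2 fun h0 => hjQ.2 ?_
  change brauerMap L Q j = 0
  have h2 : scalarExt K L G f' * brauerMap L Q j = brauerMap L Q j := by
    rw [← h1, brauerMap_mul hpQ (fixedSubalgebra_anti hQP hI) (fixedSubalgebra_anti hQP hj.mem),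
      ← hext, ← mul_assoc, ← map_mul, hiQ']
  rw [← h2, ← hjQ', ← mul_assoc, show scalarExt K L G f' * f = 0 from h0, zero_mul]

theorem IsBlockBrauerPair.tildePair [CharP L p] {b : L[G]}
    (hb : IsBlockIdempotent (⊤ : Subgroup G) b)
    {y : Subgroup G × L[G]} (hy : IsBlockBrauerPair p b y) :
    IsBlockBrauerPair p (tilde K b) (tildePair K y) := by
  obtain ⟨P, e⟩ := y
  have hpP : IsPGroup p P := hy.1.1
  have he := hy.1.2
  have hbt := hb.tilde (K := K)
  have het := he.tilde (K := K)
  have hfix : tilde K b ∈ fixedSubalgebra K P := fun g _ => conj_top_of_mem_center hbt.mem g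
  have hfixb : b ∈ fixedSubalgebra L P := fun g _ => conj_top_of_mem_center hb.mem g
  refine ⟨hy.1.tildePair, ?_⟩
  change brauerMap K P (tilde K b) * tilde K e = tilde K e
  refine (het.mul_eq_zero_or_eq (brauerMap_mem_center le_top hbt.mem)
    (by rw [← brauerMap_mul hpP hfix hfix, hbt.idem])).resolve_left fun h0 => he.ne_zero ?_
  have h1 : brauerMap L P b * e = e := hy.2
  have h2 := congrArg (fun c => scalarExt K L G c * e) h0
  simp only [map_mul, map_zero, zero_mul] at h2
  rw [mul_assoc, scalarExt_tilde_mul he, ← h1, ← mul_assoc,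
    show scalarExt K L G (brauerMap K P _) = _ from mapRingHom_brauerMap _ P _,
    ← brauerMap_mul hpP ((mapRingHom_mem_fixedSubalgebra_iff _).mpr hfix) hfixb] at h2
  change brauerMap L P (scalarExt K L G _ * b) * e = 0 at h2
  rwa [scalarExt_tilde_mul hb, h1] at h2

theorem IsMaximalBrauerPair.tildePair [CharP L p] {b : L[G]}
    (hb : IsBlockIdempotent (⊤ : Subgroup G) b) {y : Subgroup G × L[G]}
    (hy : IsMaximalBrauerPair p b y) : IsMaximalBrauerPair p (tilde K b) (tildePair K y) := by
  refine ⟨hy.1.tildePair hb, fun z hz hle => ?_⟩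
  obtain ⟨⟨R, f⟩, hx, rfl⟩ := hz.1.exists_eq_tildePair (L := L)
  obtain ⟨P, e⟩ := y
  have he : IsBrauerPair p (P, e) := hy.1.1
  obtain ⟨e₁, he₁, hle₁⟩ := hx.exists_brauerLE (show P ≤ R from hle.1)
  have hxt : IsBrauerPair p (R, tilde K f) := hx.tildePair
  have het : IsBrauerPair p (P, tilde K e) := he.tildePair
  have het₁ : IsBrauerPair p (P, tilde K e₁) := he₁.tildePair
  have hlet : BrauerLE (P, tilde K e₁) (R, tilde K f) := hle₁.tildePair he₁ hx
  have h1 : tilde K e = tilde K e₁ := hxt.brauerLE_unique het het₁ hle hlet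
  -- The pair of `LG` below `(R, f)` at `P` need not be `(P, e)`, only a Galois conjugate of it.
  -- Applying `γ` puts `(P, e)` below `γ(R, f)`, where maximality over `L` applies.
  obtain ⟨γ, hγ⟩ := he.2.exists_galoisAct_eq he₁.2 h1
  have hle₂ : BrauerLE (P, e) (galoisPair γ (R, f)) := by
    have := hle₁.galoisPair γ
    rwa [show galoisPair γ (P, e₁) = (P, e) from Prod.ext rfl hγ] at this
  obtain ⟨b', hb', hfb'⟩ := (hx.galoisPair γ).exists_isBlockBrauerPair
  have h2 := IsBlockBrauerPair.block_unique hb hb' hy.1 (hfb'.of_brauerLE hb' he hle₂)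
  subst h2
  have h3 := hy.2 _ hfb' hle₂
  rw [← hx.tildePair_galoisPair γ, h3]

end GaloisAction

/-! ### Galois conjugates of central idempotents are Frobenius powers. -/

section Frobenius

/-- On the elements fixed by a power of the Frobenius endomorphism, a ring endomorphism acts as a
power of the Frobenius endomorphism. -/
theorem exists_forall_eq_pow {L : Type*} [Field L] (p : ℕ) [Fact p.Prime] [CharP L p]
    (γ : L →+* L) {n : ℕ} (hn : n ≠ 0) :
    ∃ s : ℕ, ∀ a : L, a ^ p ^ n = a → γ a = a ^ p ^ s := by
  let E : Subfield L := (iterateFrobenius L p n).eqLocusField (RingHom.id L)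
  have hmem : ∀ a, a ∈ E ↔ a ^ p ^ n = a := fun a => by
    rw [RingHom.mem_eqLocusField, iterateFrobenius_def, RingHom.id_apply]
  have hfin : Finite E := by
    have hne := FiniteField.X_pow_card_pow_sub_X_ne_zero L hn (Fact.out : p.Prime).one_lt
    refine Set.Finite.subset (Polynomial.rootSet_finite
      (Polynomial.X ^ p ^ n - Polynomial.X : Polynomial L) L) fun a ha => ?_
    rw [Polynomial.mem_rootSet]
    refine ⟨hne, ?_⟩
    simp [(hmem a).mp ha]
  have : CharP E p := (RingHom.charP_iff E.subtype E.subtype.injective p).mpr inferInstance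
  let _ : Algebra (ZMod p) E := ZMod.algebra E p
  let γE : E →+* E := (γ.comp E.subtype).codRestrict E fun a => by
    rw [hmem]
    change γ a ^ p ^ n = γ a
    rw [← map_pow, (hmem _).mp a.2]
  have hγE : γE.comp (algebraMap (ZMod p) E) = algebraMap (ZMod p) E := RingHom.ext_zmod _ _
  let γA : E →ₐ[ZMod p] E := { γE with commutes' := fun r => RingHom.congr_fun hγE r }
  -- `E` is a finite field stable under `γ`, and its endomorphisms over the prime field are powers
  -- of Frobenius.
  obtain ⟨s, hs⟩ := (FiniteField.bijective_frobeniusAlgHom_pow (ZMod p) E).2 γA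
  refine ⟨s, fun a ha => ?_⟩
  have h1 := AlgHom.congr_fun hs ⟨a, (hmem a).mpr ha⟩
  have h2 := congrArg (fun x : E => (x : L)) h1
  simp only [AlgHom.coe_pow, FiniteField.coe_frobeniusAlgHom, pow_iterate, ZMod.card] at h2
  exact h2.symm

variable {L G : Type*} [Field L] [Group G] (p : ℕ) [Fact p.Prime] [CharP L p]

/-- The endomorphism of `LG` which raises the coefficients to their `p`-th powers. -/
noncomputable def coeffFrobenius (G : Type*) [Group G] : L[G] →+* L[G] :=
  MonoidAlgebra.mapRingHom G (frobenius L p)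

theorem coeffFrobenius_iterate (s : ℕ) (a : L[G]) (g : G) :
    ((coeffFrobenius p G)^[s] a).coeff g = a.coeff g ^ p ^ s := by
  induction s with
  | zero => simp
  | succ s ih =>
    rw [Function.iterate_succ_apply', coeffFrobenius, MonoidAlgebra.coeff_mapRingHom,
      ← coeffFrobenius, ih, frobenius_def, ← pow_mul, pow_succ]

theorem coeffFrobenius_iterate_conj (s : ℕ) (x : G) (a : L[G]) :
    (coeffFrobenius p G)^[s] (conj L x a) = conj L x ((coeffFrobenius p G)^[s] a) := by
  ext g
  rw [coeffFrobenius_iterate, coeff_conj, coeff_conj, coeffFrobenius_iterate]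

variable [Finite G]

/-- The injective coefficientwise Frobenius preserves the finite set of central idempotents, so it
permutes them. In particular the coefficients of `e` are fixed by a power of Frobenius, although `L`
may be infinite. -/
theorem exists_coeffFrobenius_iterate_eq {H : Subgroup G} {e : L[G]}
    (he : e ∈ centerSubgroupAlgebra L H) (hee : e * e = e) :
    ∃ n ≠ 0, (coeffFrobenius p G)^[n] e = e := by
  have hfin := finite_idempotents (center_mul_comm (k := L) H)
  have hmaps : ∀ s, (coeffFrobenius p G)^[s] e ∈
      {z | z ∈ centerSubgroupAlgebra L H ∧ z * z = z} := by
    intro s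
    induction s with
    | zero => exact ⟨he, hee⟩
    | succ s ih =>
      rw [Function.iterate_succ_apply']
      exact ⟨(mapRingHom_mem_center_iff _).mpr ih.1, by rw [← map_mul, ih.2]⟩
  have := hfin.to_subtype
  obtain ⟨m, n, hmn, heq⟩ := Finite.exists_ne_map_eq_of_infinite
    (fun s : ℕ => (⟨_, hmaps s⟩ : {z | z ∈ centerSubgroupAlgebra L H ∧ z * z = z}))
  have heq' : (coeffFrobenius p G)^[m] e = (coeffFrobenius p G)^[n] e := congrArg Subtype.val heq
  have hinj : Function.Injective (coeffFrobenius (L := L) p G) := mapRingHom_injective _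
  have key : ∀ m n, m < n → (coeffFrobenius p G)^[m] e = (coeffFrobenius p G)^[n] e →
      ∃ n ≠ 0, (coeffFrobenius p G)^[n] e = e := by
    intro m n hlt h
    refine ⟨n - m, by omega, hinj.iterate m ?_⟩
    rw [← Function.iterate_add_apply, Nat.add_sub_cancel' hlt.le, ← h]
  rcases lt_or_gt_of_ne hmn with h | h
  · exact key m n h heq'
  · exact key n m h heq'.symm

theorem exists_galoisAct_eq_coeffFrobenius {K : Type*} [Field K] [Algebra K L] {H : Subgroup G}
    {e : L[G]} (he : e ∈ centerSubgroupAlgebra L H) (hee : e * e = e) (γ : L ≃ₐ[K] L) :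
    ∃ s, galoisAct γ e = (coeffFrobenius p G)^[s] e := by
  obtain ⟨n, hn, hne⟩ := exists_coeffFrobenius_iterate_eq p he hee
  obtain ⟨s, hs⟩ := exists_forall_eq_pow p (γ : L →+* L) hn
  refine ⟨s, ?_⟩
  ext g
  rw [coeff_galoisAct, coeffFrobenius_iterate]
  exact hs _ (by rw [← coeffFrobenius_iterate, hne])

end Frobenius

/-! ### The stabilizers of `(P, e)` and `(P, ẽ)`. -/

section Normalizer

variable {K L G : Type*} [Field K] [Field L] [Algebra K L] [FiniteDimensional K L] [IsGalois K L]
  [Group G] {p : ℕ}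

theorem pairNormalizer_le_tildePair {y : Subgroup G × L[G]} (hy : IsBrauerPair p y) :
    pairNormalizer y ≤ pairNormalizer (tildePair K y) := by
  intro x hx
  change conjPair x (tildePair K y) = tildePair K y
  rw [← hy.tildePair_conjPair (K := K), show conjPair x y = y from hx]

theorem exists_conjPair_eq_galoisPair {y : Subgroup G × L[G]} (hy : IsBrauerPair p y) {x : G}
    (hx : x ∈ pairNormalizer (tildePair K y)) :
    ∃ γ : L ≃ₐ[K] L, conjPair x y = galoisPair γ y := by
  have hx' : conjPair x (tildePair K y) = tildePair K y := hx
  have h1 : y.1.map (MulAut.conj x).toMonoidHom = y.1 := congrArg Prod.fst hx'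
  have h2 : conj K x (tilde K y.2) = tilde K y.2 := congrArg Prod.snd hx'
  have h3 : IsBlockIdempotent (Subgroup.centralizer (y.1 : Set G)) (conj L x y.2) := by
    have := (hy.map_conj x).2
    change IsBlockIdempotent (Subgroup.centralizer ((y.1.map _ : Subgroup G) : Set G)) _ at this
    rwa [h1] at this
  obtain ⟨γ, hγ⟩ := h3.exists_galoisAct_eq (K := K) hy.2 (by rw [hy.2.tilde_conj, h2])
  exact ⟨γ, Prod.ext h1 hγ.symm⟩

theorem exists_zpow_conjPair_eq {y : Subgroup G × L[G]}
    [((pairNormalizer y).subgroupOf (pairNormalizer (tildePair K y))).Normal]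
    {g₀ : pairNormalizer (tildePair K y)}
    (hg₀ : Subgroup.zpowers (QuotientGroup.mk g₀ : pairNormalizer (tildePair K y) ⧸
      (pairNormalizer y).subgroupOf (pairNormalizer (tildePair K y))) = ⊤)
    {x : G} (hx : x ∈ pairNormalizer (tildePair K y)) :
    ∃ m : ℤ, conjPair x y = conjPair ((g₀ ^ m : pairNormalizer (tildePair K y)) : G) y := by
  have h1 : (QuotientGroup.mk (⟨x, hx⟩ : pairNormalizer (tildePair K y)) :
      pairNormalizer (tildePair K y) ⧸
        (pairNormalizer y).subgroupOf (pairNormalizer (tildePair K y))) ∈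
      Subgroup.zpowers (QuotientGroup.mk g₀ : pairNormalizer (tildePair K y) ⧸
        (pairNormalizer y).subgroupOf (pairNormalizer (tildePair K y))) := by
    rw [hg₀]; trivial
  obtain ⟨m, hm⟩ := Subgroup.mem_zpowers_iff.mp h1
  refine ⟨m, ?_⟩
  rw [← QuotientGroup.mk_zpow] at hm
  have h2 := Subgroup.mem_subgroupOf.mp (QuotientGroup.eq.mp hm)
  have h3 : conjPair ((((g₀ ^ m)⁻¹ * ⟨x, hx⟩ : pairNormalizer (tildePair K y))) : G) y = y := h2
  refine Eq.trans ?_ (congrArg (conjPair _) h3)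
  rw [← conjPair_mul, ← Subgroup.coe_mul, mul_inv_cancel_left]

variable [Finite G] [Fact p.Prime] [CharP L p]

/-- The quotient `N_G(P, ẽ) / N_G(P, e)` embeds into a cyclic group. -/
theorem exists_hom_ker_eq {y : Subgroup G × L[G]} (hy : IsBrauerPair p y) :
    ∃ (r : ℕ) (θ : pairNormalizer (tildePair K y) →* Multiplicative (ZMod r)),
      θ.ker = (pairNormalizer y).subgroupOf (pairNormalizer (tildePair K y)) := by
  set φ := coeffFrobenius (L := L) p G with hφ
  -- The exponent `s` with `c_g(e) = φ^s(e)` is determined modulo the period `r` of `e`. It is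
  -- additive in `g` because conjugation commutes with `φ`.
  set r := Function.minimalPeriod φ y.2 with hr
  obtain ⟨n, hn, hne⟩ := exists_coeffFrobenius_iterate_eq p hy.2.mem hy.2.idem
  have hr0 : 0 < r :=
    Function.minimalPeriod_pos_of_mem_periodicPts ⟨n, Nat.pos_of_ne_zero hn, hne⟩
  have hiff : ∀ s t : ℕ, φ^[s] y.2 = φ^[t] y.2 ↔ (s : ZMod r) = t := by
    intro s t
    rw [ZMod.natCast_eq_natCast_iff']
    rw [← Function.iterate_mod_minimalPeriod_eq (n := s),
      ← Function.iterate_mod_minimalPeriod_eq (n := t)]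
    exact Function.iterate_eq_iterate_iff_of_lt_minimalPeriod (Nat.mod_lt _ hr0) (Nat.mod_lt _ hr0)
  have hex : ∀ g : pairNormalizer (tildePair K y), ∃ s, conj L (g : G) y.2 = φ^[s] y.2 := by
    intro g
    obtain ⟨γ, hγ⟩ := exists_conjPair_eq_galoisPair hy g.2
    obtain ⟨s, hs⟩ := exists_galoisAct_eq_coeffFrobenius p hy.2.mem hy.2.idem γ
    exact ⟨s, (congrArg Prod.snd hγ).trans hs⟩
  choose s hs using hex
  have hmul : ∀ g h : pairNormalizer (tildePair K y), Multiplicative.ofAdd (s (g * h) : ZMod r) =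
      Multiplicative.ofAdd (s g : ZMod r) * Multiplicative.ofAdd (s h : ZMod r) := by
    intro g h
    rw [← ofAdd_add, ← Nat.cast_add]
    congr 1
    rw [← hiff, ← hs, Subgroup.coe_mul, conj_mul_apply, hs h, ← coeffFrobenius_iterate_conj, hs g,
      ← Function.iterate_add_apply, add_comm]
  refine ⟨r, MonoidHom.mk' (fun g => Multiplicative.ofAdd (s g : ZMod r)) hmul, ?_⟩
  · ext g
    rw [MonoidHom.mem_ker, Subgroup.mem_subgroupOf]
    have h1 : MonoidHom.mk' (fun g => Multiplicative.ofAdd (s g : ZMod r)) hmul g = 1 ↔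
        (s g : ZMod r) = (0 : ℕ) := by
      rw [Nat.cast_zero]
      exact Iff.rfl
    refine h1.trans ?_
    rw [← hiff, ← hs, Function.iterate_zero_apply]
    have h2 : y.1.map (MulAut.conj (g : G)).toMonoidHom = y.1 :=
      congrArg Prod.fst (show conjPair (g : G) (tildePair K y) = tildePair K y from g.2)
    exact ⟨fun h => Prod.ext h2 h, fun h => congrArg Prod.snd h⟩

theorem pairNormalizer_subgroupOf_normal {y : Subgroup G × L[G]} (hy : IsBrauerPair p y) :
    ((pairNormalizer y).subgroupOf (pairNormalizer (tildePair K y))).Normal := by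
  obtain ⟨r, θ, hθ⟩ := exists_hom_ker_eq (K := K) hy
  rw [← hθ]
  infer_instance

theorem isCyclic_pairNormalizer_quotient {y : Subgroup G × L[G]} (hy : IsBrauerPair p y)
    [((pairNormalizer y).subgroupOf (pairNormalizer (tildePair K y))).Normal] :
    IsCyclic (pairNormalizer (tildePair K y) ⧸
      (pairNormalizer y).subgroupOf (pairNormalizer (tildePair K y))) := by
  obtain ⟨r, θ, hθ⟩ := exists_hom_ker_eq (K := K) hy
  exact isCyclic_of_injective ((QuotientGroup.kerLift θ).comp
    (QuotientGroup.quotientMulEquivOfEq hθ.symm).toMonoidHom)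
    ((QuotientGroup.kerLift_injective θ).comp (MulEquiv.injective _))

end Normalizer

/-! ### Powers and restrictions of an automorphism in a fusion system. -/

section FusionSystems

variable {P : Type*} [Group P] {E : HomFamily P}

theorem IsFusionSystem.inclusion_mem (hE : IsFusionSystem E) {Q R : Subgroup P} (h : Q ≤ R) :
    Subgroup.inclusion h ∈ E Q R :=
  hE.conj_mem _ ⟨1, fun u => by simp⟩

theorem IsFusionSystem.restrictAut_mem (hE : IsFusionSystem E) {τ : MulAut P} (hτ : MemAut E τ)
    (Q R : Subgroup P) (h : Q.map τ.toMonoidHom ≤ R) : restrictAut τ Q R h ∈ E Q R := by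
  have h1 := hE.comp_mem _ _ (hE.inclusion_mem (le_top : Q ≤ ⊤)) hτ
  have h2 : image ((restrictAut τ ⊤ ⊤ le_top).comp (Subgroup.inclusion (le_top : Q ≤ ⊤))) ≤ R := by
    rintro _ ⟨u, rfl⟩
    exact h ⟨u, u.2, rfl⟩
  exact hE.comp_mem _ _ (hE.toImage_mem _ h1) (hE.inclusion_mem h2)

theorem IsFusionSystem.memAut_one (hE : IsFusionSystem E) : MemAut E 1 := hE.id_mem ⊤

theorem IsFusionSystem.memAut_mul (hE : IsFusionSystem E) {σ τ : MulAut P} (hσ : MemAut E σ)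
    (hτ : MemAut E τ) : MemAut E (σ * τ) := hE.comp_mem _ _ hτ hσ

theorem IsFusionSystem.memAut_inv (hE : IsFusionSystem E) {σ : MulAut P} (hσ : MemAut E σ) :
    MemAut E σ⁻¹ := by
  obtain ⟨θ, hθ, hθu⟩ := hE.inv_mem _ hσ
  have hle : ⊤ ≤ image (restrictAut σ ⊤ ⊤ le_top) := by
    intro u _
    exact ⟨⟨σ⁻¹ u, trivial⟩, MulAut.apply_inv_self P σ u⟩
  have h1 := hE.comp_mem _ _ (hE.inclusion_mem hle) hθ
  have h2 : restrictAut σ⁻¹ ⊤ ⊤ le_top = θ.comp (Subgroup.inclusion hle) := by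
    refine MonoidHom.ext fun u => ?_
    rw [MonoidHom.comp_apply]
    have h3 := hθu ⟨σ⁻¹ u, trivial⟩
    have h4 : toImage (restrictAut σ ⊤ ⊤ le_top) ⟨σ⁻¹ u, trivial⟩ = Subgroup.inclusion hle u :=
      Subtype.ext (MulAut.apply_inv_self P σ u)
    rw [← h4, h3]
    rfl
  change restrictAut σ⁻¹ ⊤ ⊤ le_top ∈ E ⊤ ⊤
  rwa [h2]

theorem IsFusionSystem.memAut_zpow (hE : IsFusionSystem E) {σ : MulAut P} (hσ : MemAut E σ)
    (i : ℤ) : MemAut E (σ ^ i) := by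
  let A : Subgroup (MulAut P) :=
    { carrier := {τ | MemAut E τ}
      one_mem' := hE.memAut_one
      mul_mem' := hE.memAut_mul
      inv_mem' := hE.memAut_inv }
  exact A.zpow_mem (show σ ∈ A from hσ) i

end FusionSystems

/-! ### The fusion system of a block satisfies the axioms. -/

section BlockFusionSystems

variable {k G : Type*} [Field k] [Group G] {x : Subgroup G × k[G]}

theorem IsBrauerPair.conjPair_eq_self {p : ℕ} (hx : IsBrauerPair p x) {g : G} (hg : g ∈ x.1) :
    conjPair g x = x := by
  refine Prod.ext (map_conj_eq_self (Subgroup.le_normalizer hg)) ?_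
  exact subgroupAlgebra_centralizer_le x.1 (mem_subgroupAlgebra_of_mem_center hx.2.mem) g hg

theorem map_subtype_image {Q R : Subgroup x.1} {φ : Q →* R} {g : G}
    (hφ : ∀ u : Q, ((φ u : x.1) : G) = g * ((u : x.1) : G) * g⁻¹) :
    (image φ).map x.1.subtype = (Q.map x.1.subtype).map (MulAut.conj g).toMonoidHom := by
  ext v
  constructor
  · rintro ⟨_, ⟨u, rfl⟩, rfl⟩
    exact ⟨_, ⟨u, u.2, rfl⟩, (hφ u).symm⟩
  · rintro ⟨_, ⟨u, hu, rfl⟩, rfl⟩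
    exact ⟨_, ⟨⟨u, hu⟩, rfl⟩, hφ ⟨u, hu⟩⟩

theorem map_conjAut_map_subtype (h : pairNormalizer x) (Q : Subgroup x.1) :
    (Q.map (conjAut x h).toMonoidHom).map x.1.subtype =
      (Q.map x.1.subtype).map (MulAut.conj (h : G)).toMonoidHom := by
  rw [Subgroup.map_map, Subgroup.map_map]
  rfl

theorem memAut_conjAut {p : ℕ} (hx : IsBrauerPair p x) (h : pairNormalizer x) :
    MemAut (blockFusion p x) (conjAut x h) := by
  have htop : (⊤ : Subgroup x.1).map x.1.subtype = x.1 := by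
    rw [← MonoidHom.range_eq_map, Subgroup.range_subtype]
  have hpair : ((⊤ : Subgroup x.1).map x.1.subtype, x.2) = x := Prod.ext htop rfl
  refine ⟨h, x.2, x.2, ?_, ?_, fun u => rfl, ?_⟩
  · rw [hpair]; exact ⟨hx, BrauerLE.refl _⟩
  · rw [hpair]; exact ⟨hx, BrauerLE.refl _⟩
  · rw [hpair, show conjPair (h : G) x = x from h.2]
    exact BrauerLE.refl _

variable [Finite G] {p : ℕ} [Fact p.Prime] [CharP k p]

theorem IsBrauerPair.eq_of_brauerLE {y z : Subgroup G × k[G]} (hy : IsBrauerPair p y)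
    (hz : IsBrauerPair p z) (h : BrauerLE y z) (h1 : y.1 = z.1) : y = z := by
  obtain ⟨P, e⟩ := y
  obtain ⟨P', e'⟩ := z
  obtain rfl : P = P' := h1
  rw [hz.brauerLE_unique hy hz h (BrauerLE.refl _)]

theorem IsBrauerPair.isFusionSystem_blockFusion (hx : IsBrauerPair p x) :
    IsFusionSystem (blockFusion p x) := by
  have hex : ∀ Q : Subgroup x.1, ∃ eQ, IsBrauerPair p (Q.map x.1.subtype, eQ) ∧
      BrauerLE (Q.map x.1.subtype, eQ) x := fun Q =>
    IsBrauerPair.exists_brauerLE hx (Subgroup.map_subtype_le Q)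
  -- A morphism induced by `g` carries `(Q, e_Q)` to the pair below `x` at the image, whose block is
  -- `c_g(e_Q)` by transitivity. This yields the axioms on images and inverses.
  have himage : ∀ {Q R : Subgroup x.1} {φ : Q →* R}, φ ∈ blockFusion p x Q R → ∃ (g : G) (eQ : k[G]),
      (IsBrauerPair p (Q.map x.1.subtype, eQ) ∧ BrauerLE (Q.map x.1.subtype, eQ) x) ∧
      (∀ u : Q, ((φ u : x.1) : G) = g * ((u : x.1) : G) * g⁻¹) ∧
      IsBrauerPair p ((image φ).map x.1.subtype, conj k g eQ) ∧
      BrauerLE ((image φ).map x.1.subtype, conj k g eQ) x ∧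
      conjPair g (Q.map x.1.subtype, eQ) = ((image φ).map x.1.subtype, conj k g eQ) := by
    rintro Q R φ ⟨g, eQ, eR, hQ, hR, hφ, hle⟩
    have heq : conjPair g (Q.map x.1.subtype, eQ) = ((image φ).map x.1.subtype, conj k g eQ) :=
      Prod.ext (map_subtype_image hφ).symm rfl
    refine ⟨g, eQ, hQ, hφ, heq ▸ hQ.1.map_conj g, ?_, heq⟩
    rw [← heq]
    exact hle.trans (hQ.1.map_conj g) hR.1 hx hR.2
  refine ⟨?_, ?_, ?_, ?_, ?_, ?_⟩
  · intro Q
    obtain ⟨eQ, hQ⟩ := hex Q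
    refine ⟨1, eQ, eQ, hQ, hQ, fun u => by simp, ?_⟩
    rw [conjPair_one]
    exact BrauerLE.refl _
  · rintro Q R S φ ψ ⟨g, eQ, eR, hQ, hR, hφ, hle⟩ ⟨h, eR', eS, hR', hS, hψ, hle'⟩
    obtain rfl : eR = eR' := hx.brauerLE_unique hR.1 hR'.1 hR.2 hR'.2
    refine ⟨h * g, eQ, eS, hQ, hS, fun u => ?_, ?_⟩
    · rw [MonoidHom.comp_apply, hψ, hφ]
      group
    · rw [conjPair_mul]
      exact (hle.map_conj h).trans ((hQ.1.map_conj g).map_conj h) (hR.1.map_conj h) hS.1 hle'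
  · rintro Q R φ ⟨g, hφ⟩
    have hφ' : ∀ u : Q, ((φ u : x.1) : G) = g * ((u : x.1) : G) * (g : G)⁻¹ := by
      intro u
      rw [hφ]
      rfl
    obtain ⟨eQ, hQ⟩ := hex Q
    obtain ⟨eR, hR⟩ := hex R
    refine ⟨g, eQ, eR, hQ, hR, hφ', ?_⟩
    have h1 := hQ.2.map_conj (g : G)
    rw [hx.conjPair_eq_self g.2] at h1
    refine BrauerLE.of_le_of_le (hQ.1.map_conj g) hR.1 hx h1 hR.2 ?_
    rw [← map_subtype_image hφ']
    refine Subgroup.map_mono ?_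
    rintro _ ⟨u, rfl⟩
    exact (φ u).2
  · rintro Q R φ ⟨g, eQ, eR, hQ, hR, hφ, hle⟩ u v huv
    have h1 := hφ u
    rw [huv, hφ v] at h1
    exact (Subtype.ext (Subtype.ext (by simpa using h1))).symm
  · intro Q R φ hmem
    obtain ⟨g, eQ, hQ, hφ, h1, h2, h3⟩ := himage hmem
    exact ⟨g, eQ, _, hQ, ⟨h1, h2⟩, hφ, h3 ▸ BrauerLE.refl _⟩
  · intro Q R φ hmem
    obtain ⟨g, eQ, hQ, hφ, h1, h2, h3⟩ := himage hmem
    have hinj : Function.Injective (R.subtype.comp φ) := by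
      intro u v huv
      have h4 := hφ u
      rw [show ((φ u : x.1) : G) = (φ v : x.1) from congrArg _ huv, hφ v] at h4
      exact (Subtype.ext (Subtype.ext (by simpa using h4))).symm
    have hθ : ∀ u : Q, (MonoidHom.ofInjective hinj).symm (toImage φ u) = u := fun u =>
      (MonoidHom.ofInjective hinj).symm_apply_apply u
    refine ⟨(MonoidHom.ofInjective hinj).symm.toMonoidHom, ?_, hθ⟩
    refine ⟨g⁻¹, _, eQ, ⟨h1, h2⟩, hQ, ?_, ?_⟩
    · rintro ⟨_, u, rfl⟩
      have h5 : ((MonoidHom.ofInjective hinj).symm.toMonoidHom (toImage φ u)) = u := hθ u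
      change ((((MonoidHom.ofInjective hinj).symm.toMonoidHom (toImage φ u) : Q) : x.1) : G) =
        g⁻¹ * ((φ u : x.1) : G) * g⁻¹⁻¹
      rw [h5, hφ]
      group
    · rw [← h3, ← conjPair_mul, inv_mul_cancel, conjPair_one]
      exact BrauerLE.refl _

end BlockFusionSystems

/-! ### Comparison of the fusion systems over `K` and `L`. -/

section Extension

variable {K L G : Type*} [Field K] [Field L] [Algebra K L] [FiniteDimensional K L] [IsGalois K L]
  [Group G] [Finite G] {p : ℕ} [Fact p.Prime] [CharP K p] [CharP L p] {P : Subgroup G} {e : L[G]}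

theorem blockFusion_subset_tilde (he : IsBrauerPair p (P, e)) (Q R : Subgroup P) :
    (blockFusion p (P, e) : HomFamily P) Q R ⊆ (blockFusion p (P, tilde K e) : HomFamily P) Q R := by
  rintro φ ⟨g, eQ, eR, hQ, hR, hφ, hle⟩
  refine ⟨g, tilde K eQ, tilde K eR, ⟨hQ.1.tildePair, hQ.2.tildePair hQ.1 he⟩,
    ⟨hR.1.tildePair, hR.2.tildePair hR.1 he⟩, hφ, ?_⟩
  have h1 := hle.tildePair (K := K) (hQ.1.map_conj g) hR.1
  rwa [hQ.1.tildePair_conjPair] at h1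

/-- The block below `(R, eR)` at `gQg⁻¹` has the same orbit sum as `c_g(eQ)`, hence is a Galois
conjugate of it; this gives `γ`. Tracing blocks shows that `γ(P, e)` is again a pair of `b`, and
comparison with the maximal pair `(P, e)` gives `h`. -/
theorem exists_galoisPair_brauerLE {b : L[G]} (hb : IsBlockIdempotent (⊤ : Subgroup G) b)
    (hmax : IsMaximalBrauerPair p b (P, e)) {Q R : Subgroup P} {φ : Q →* R}
    (hφ : φ ∈ (blockFusion p (P, tilde K e) : HomFamily P) Q R) :
    ∃ (g h : G) (γ : L ≃ₐ[K] L) (eQ eR : L[G]),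
      (IsBrauerPair p (Q.map P.subtype, eQ) ∧ BrauerLE (Q.map P.subtype, eQ) (P, e)) ∧
      (IsBrauerPair p (R.map P.subtype, eR) ∧ BrauerLE (R.map P.subtype, eR) (P, e)) ∧
      (∀ u : Q, ((φ u : P) : G) = g * ((u : P) : G) * g⁻¹) ∧
      BrauerLE (conjPair g (galoisPair γ (Q.map P.subtype, eQ))) (R.map P.subtype, eR) ∧
      h ∈ pairNormalizer (P, tilde K e) ∧ galoisPair γ (P, e) = conjPair h (P, e) := by
  have he := hmax.1.1
  have het : IsBrauerPair p (P, tilde K e) := he.tildePair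
  obtain ⟨g, eQ', eR', hQ', hR', hφg, hle⟩ := hφ
  change (IsBrauerPair p (Q.map P.subtype, eQ') ∧
    BrauerLE (Q.map P.subtype, eQ') (P, tilde K e)) at hQ'
  change (IsBrauerPair p (R.map P.subtype, eR') ∧
    BrauerLE (R.map P.subtype, eR') (P, tilde K e)) at hR'
  change BrauerLE (conjPair g (Q.map P.subtype, eQ')) (R.map P.subtype, eR') at hle
  obtain ⟨eQ, hQ, hQP⟩ := he.exists_brauerLE (Subgroup.map_subtype_le Q)
  obtain ⟨eR, hR, hRP⟩ := he.exists_brauerLE (Subgroup.map_subtype_le R)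
  obtain rfl : tilde K eQ = eQ' := het.brauerLE_unique hQ.tildePair hQ'.1
    (hQP.tildePair hQ he) hQ'.2
  obtain rfl : tilde K eR = eR' := het.brauerLE_unique hR.tildePair hR'.1
    (hRP.tildePair hR he) hR'.2
  obtain ⟨f, hf, hfR⟩ := hR.exists_brauerLE (Q := (conjPair g (Q.map P.subtype, eQ)).1) hle.1
  have hQg := hQ.map_conj g
  have hlet : BrauerLE (conjPair g (Q.map P.subtype, tilde K eQ)) (R.map P.subtype, tilde K eR) :=
    hle
  have h1 : BlockFusion.tildePair K (conjPair g (Q.map P.subtype, eQ)) =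
      conjPair g (Q.map P.subtype, tilde K eQ) := hQ.tildePair_conjPair g
  rw [← h1] at hlet
  have h2 : tilde K f = tilde K (conj L g eQ) :=
    IsBrauerPair.brauerLE_unique (hR.tildePair (K := K)) (hf.tildePair (K := K))
      (hQg.tildePair (K := K)) (hfR.tildePair hf hR) hlet
  obtain ⟨γ, hγ⟩ := hf.2.exists_galoisAct_eq hQg.2 h2
  have hA : BrauerLE (conjPair g (galoisPair γ (Q.map P.subtype, eQ))) (R.map P.subtype, eR) := by
    rw [← galoisPair_conjPair]
    have h3 : galoisPair γ (conjPair g (Q.map P.subtype, eQ)) =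
        ((conjPair g (Q.map P.subtype, eQ)).1, f) := Prod.ext rfl hγ
    rw [h3]
    exact hfR
  have hQγ := hQ.galoisPair γ
  have heγ := he.galoisPair γ
  have h4 : IsBlockBrauerPair p b (galoisPair γ (Q.map P.subtype, eQ)) := by
    have h5 := (hmax.1.of_brauerLE hb (hQγ.map_conj g)
      (hA.trans (hQγ.map_conj g) hR he hRP)).map_conj hb.mem g⁻¹
    rwa [← conjPair_mul, inv_mul_cancel, conjPair_one] at h5
  obtain ⟨b', hb', heb'⟩ := heγ.exists_isBlockBrauerPair
  obtain rfl := IsBlockBrauerPair.block_unique hb hb' h4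
    (heb'.of_brauerLE hb' hQγ (hQP.galoisPair γ))
  obtain ⟨h, hh⟩ := hmax.exists_brauerLE_conjPair hb heb'
  have h6 : P = P.map (MulAut.conj h).toMonoidHom := by
    have h7 : P ≤ P.map (MulAut.conj h).toMonoidHom := hh.1
    -- The inclusion `P ≤ hPh⁻¹` is an equality because the image has at most as many elements as
    -- `P`.
    refine SetLike.coe_injective (Set.eq_of_subset_of_ncard_le h7 ?_ (Set.toFinite _))
    rw [Subgroup.coe_map]
    exact Set.ncard_image_le (Set.toFinite _)
  have h8 := heγ.eq_of_brauerLE (he.map_conj h) hh h6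
  refine ⟨g, h, γ, eQ, eR, ⟨hQ, hQP⟩, ⟨hR, hRP⟩, hφg, hA, ?_, h8⟩
  change conjPair h (BlockFusion.tildePair K (P, e)) = BlockFusion.tildePair K (P, e)
  rw [← he.tildePair_conjPair, ← h8, he.tildePair_galoisPair]

theorem exists_comp_restrictAut {b : L[G]} (hb : IsBlockIdempotent (⊤ : Subgroup G) b)
    (hmax : IsMaximalBrauerPair p b (P, e))
    [((pairNormalizer (P, e)).subgroupOf (pairNormalizer (P, tilde K e))).Normal]
    {g₀ : pairNormalizer (P, tilde K e)}
    (hg₀ : Subgroup.zpowers (QuotientGroup.mk g₀ : pairNormalizer (P, tilde K e) ⧸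
      (pairNormalizer (P, e)).subgroupOf (pairNormalizer (P, tilde K e))) = ⊤)
    {σ : MulAut P} (hσ : σ = conjAut (P, tilde K e) g₀) {Q R : Subgroup P} {φ : Q →* R}
    (hφ : φ ∈ (blockFusion p (P, tilde K e) : HomFamily P) Q R) :
    ∃ i : ℤ,
      ∃ ψ ∈ (blockFusion p (P, e) : HomFamily P) Q (R.map (σ ^ (-i)).toMonoidHom),
      ∃ ψ' ∈ (blockFusion p (P, e) : HomFamily P) (Q.map (σ ^ i).toMonoidHom) R,
        φ = (restrictAut (σ ^ i) (R.map (σ ^ (-i)).toMonoidHom) R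
              (map_zpow_neg_le σ i R)).comp ψ ∧
        φ = ψ'.comp (restrictAut (σ ^ i) Q (Q.map (σ ^ i).toMonoidHom) le_rfl) := by
  have he := hmax.1.1
  obtain ⟨g, x, γ, eQ, eR, ⟨hQ, hQP⟩, ⟨hR, hRP⟩, hφg, hle, hx, hγx⟩ :=
    exists_galoisPair_brauerLE hb hmax hφ
  have hnormal : ((pairNormalizer (P, e)).subgroupOf
    (pairNormalizer (BlockFusion.tildePair K (P, e)))).Normal := ‹_›
  obtain ⟨m, hm⟩ := exists_zpow_conjPair_eq (y := (P, e)) hg₀ hx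
  -- The sign is chosen so that conjugation by `h` is `σ ^ (-i)`: composing `φ` with it on either
  -- side cancels the twist by `γ`.
  obtain ⟨i, rfl⟩ : ∃ i, m = -i := ⟨-m, (neg_neg m).symm⟩
  set h : G := ((g₀ ^ (-i) : pairNormalizer (P, tilde K e)) : G) with hh
  have hγh : galoisPair γ (P, e) = conjPair h (P, e) := hγx.trans hm
  have hσm : σ ^ (-i) = conjAut (P, tilde K e) (g₀ ^ (-i)) := by rw [hσ, map_zpow]
  have hσm' : σ ^ i = conjAut (P, tilde K e) (g₀ ^ (-i))⁻¹ := by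
    rw [zpow_neg, inv_inv, hσ, map_zpow]
  have hσ_apply : ∀ u : P, ((σ ^ (-i)) u : G) = h * u * h⁻¹ := fun u => by rw [hσm]; rfl
  have hcancel : ∀ u : P, (σ ^ i) ((σ ^ (-i)) u) = u := fun u => by
    rw [← MulAut.mul_apply, ← zpow_add, add_neg_cancel, zpow_zero, MulAut.one_apply]
  have hcancel' : ∀ u : P, (σ ^ (-i)) ((σ ^ i) u) = u := fun u => by
    rw [← MulAut.mul_apply, ← zpow_add, neg_add_cancel, zpow_zero, MulAut.one_apply]
  have hmapR : (R.map (σ ^ (-i)).toMonoidHom).map P.subtype =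
      (R.map P.subtype).map (MulAut.conj h).toMonoidHom := by
    rw [hσm]
    exact map_conjAut_map_subtype (x := (P, tilde K e)) _ R
  have hmapQ : (Q.map (σ ^ i).toMonoidHom).map P.subtype =
      (Q.map P.subtype).map (MulAut.conj h⁻¹).toMonoidHom := by
    rw [hσm']
    exact map_conjAut_map_subtype (x := (P, tilde K e)) _ Q
  have hγinv : conjPair h (galoisPair γ⁻¹ (P, e)) = (P, e) := by
    rw [← galoisPair_conjPair, ← hγh, galoisPair_inv_galoisPair]
  have hQle : (Q.map (σ ^ i).toMonoidHom).map (σ ^ (-i)).toMonoidHom ≤ Q := by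
    have h1 := map_zpow_neg_le σ (-i) Q
    rwa [neg_neg] at h1
  -- Here `ψ = σ^(-i) ∘ φ` is induced by `h * g` and `ψ' = φ ∘ σ^(-i)` by `g * h`. The blocks at
  -- `σ^(-i)(R)` and `σ^i(Q)` are found by applying `ʰγ⁻¹` and its inverse, which fix `(P, e)`, to
  -- `(R, eR)` and `(Q, eQ)`.
  refine ⟨i, (restrictAut (σ ^ (-i)) R (R.map (σ ^ (-i)).toMonoidHom) le_rfl).comp φ, ?_,
    φ.comp (restrictAut (σ ^ (-i)) (Q.map (σ ^ i).toMonoidHom) Q hQle), ?_, ?_, ?_⟩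
  · have hpair : conjPair h (galoisPair γ⁻¹ (R.map P.subtype, eR)) =
        ((R.map (σ ^ (-i)).toMonoidHom).map P.subtype, conj L h (galoisAct γ⁻¹ eR)) :=
      Prod.ext hmapR.symm rfl
    have hRγ := hR.galoisPair γ⁻¹
    refine ⟨h * g, eQ, conj L h (galoisAct γ⁻¹ eR), ⟨hQ, hQP⟩, ?_, ?_, ?_⟩
    · change IsBrauerPair p ((R.map (σ ^ (-i)).toMonoidHom).map P.subtype, _) ∧
        BrauerLE ((R.map (σ ^ (-i)).toMonoidHom).map P.subtype, _) (P, e)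
      rw [← hpair]
      refine ⟨hRγ.map_conj h, ?_⟩
      have h1 := (hRP.galoisPair γ⁻¹).map_conj h
      rwa [hγinv] at h1
    · intro u
      change (((σ ^ (-i)) (φ u : P) : P) : G) = _
      rw [hσ_apply, hφg]
      group
    · change BrauerLE (conjPair (h * g) (Q.map P.subtype, eQ))
        ((R.map (σ ^ (-i)).toMonoidHom).map P.subtype, _)
      rw [← hpair, conjPair_mul]
      have h1 := hle.galoisPair γ⁻¹
      rw [galoisPair_conjPair, galoisPair_inv_galoisPair] at h1
      exact h1.map_conj h
  · have hpair : conjPair h⁻¹ (galoisPair γ (Q.map P.subtype, eQ)) =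
        ((Q.map (σ ^ i).toMonoidHom).map P.subtype, conj L h⁻¹ (galoisAct γ eQ)) :=
      Prod.ext hmapQ.symm rfl
    refine ⟨g * h, conj L h⁻¹ (galoisAct γ eQ), eR, ?_, ⟨hR, hRP⟩, ?_, ?_⟩
    · change IsBrauerPair p ((Q.map (σ ^ i).toMonoidHom).map P.subtype, _) ∧
        BrauerLE ((Q.map (σ ^ i).toMonoidHom).map P.subtype, _) (P, e)
      rw [← hpair]
      refine ⟨(hQ.galoisPair γ).map_conj h⁻¹, ?_⟩
      have h1 := (hQP.galoisPair γ).map_conj h⁻¹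
      rwa [hγh, ← conjPair_mul, inv_mul_cancel, conjPair_one] at h1
    · intro u
      rw [MonoidHom.comp_apply, hφg]
      change g * (((σ ^ (-i)) (u : P) : P) : G) * g⁻¹ = _
      rw [hσ_apply]
      group
    · change BrauerLE (conjPair (g * h) ((Q.map (σ ^ i).toMonoidHom).map P.subtype, _))
        (R.map P.subtype, eR)
      rw [← hpair, ← conjPair_mul, mul_inv_cancel_right]
      exact hle
  · refine MonoidHom.ext fun u => Subtype.ext ?_
    exact (hcancel (φ u)).symm
  · refine MonoidHom.ext fun u => ?_
    rw [MonoidHom.comp_apply, MonoidHom.comp_apply]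
    congr 1
    exact Subtype.ext (hcancel' u).symm

theorem blockFusion_tilde_eq_generated {b : L[G]} (hb : IsBlockIdempotent (⊤ : Subgroup G) b)
    (hmax : IsMaximalBrauerPair p b (P, e))
    [((pairNormalizer (P, e)).subgroupOf (pairNormalizer (P, tilde K e))).Normal]
    {g₀ : pairNormalizer (P, tilde K e)}
    (hg₀ : Subgroup.zpowers (QuotientGroup.mk g₀ : pairNormalizer (P, tilde K e) ⧸
      (pairNormalizer (P, e)).subgroupOf (pairNormalizer (P, tilde K e))) = ⊤)
    {σ : MulAut P} (hσ : σ = conjAut (P, tilde K e) g₀) :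
    (blockFusion p (P, tilde K e) : HomFamily P) = generated (blockFusion p (P, e)) σ := by
  have he := hmax.1.1
  have het : IsBrauerPair p (P, tilde K e) := he.tildePair
  funext Q R
  refine Set.Subset.antisymm ?_ ?_
  · intro φ hφ E hE hFE hEσ
    obtain ⟨i, ψ, hψ, -, -, hφψ, -⟩ := exists_comp_restrictAut hb hmax hg₀ hσ hφ
    rw [hφψ]
    exact hE.comp_mem _ _ (hFE _ _ hψ) (hE.restrictAut_mem (hE.memAut_zpow hEσ i) _ _ _)
  · intro φ hφ
    refine hφ _ het.isFusionSystem_blockFusion (blockFusion_subset_tilde he) ?_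
    rw [hσ]
    exact memAut_conjAut het g₀

end Extension

end BlockFusion

theorem theorem5p2 {K L G : Type*} [Field K] [Field L] [Algebra K L] [FiniteDimensional K L]
    [IsGalois K L] [Group G] [Finite G] (p : ℕ) [Fact p.Prime] [CharP K p]
    (b : MonoidAlgebra L G) (hb : BlockFusion.IsBlockIdempotent (⊤ : Subgroup G) b)
    (P : Subgroup G) (e : MonoidAlgebra L G) (hPe : BlockFusion.IsMaximalBrauerPair p b (P, e)) :
    -- `b̃` is a block idempotent of `KG`, and `(P, ẽ)` is a maximal `(KG, b̃)`-Brauer pair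
    BlockFusion.IsBlockIdempotent (⊤ : Subgroup G) (BlockFusion.tilde K b) ∧
    BlockFusion.IsMaximalBrauerPair p (BlockFusion.tilde K b) (P, BlockFusion.tilde K e) ∧
    -- `N_G(P, e)` is a normal subgroup of `N_G(P, ẽ)` with cyclic quotient
    BlockFusion.pairNormalizer (P, e) ≤ BlockFusion.pairNormalizer (P, BlockFusion.tilde K e) ∧
    ∃ _ : ((BlockFusion.pairNormalizer (P, e)).subgroupOf
        (BlockFusion.pairNormalizer (P, BlockFusion.tilde K e))).Normal,
      IsCyclic (BlockFusion.pairNormalizer (P, BlockFusion.tilde K e) ⧸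
        (BlockFusion.pairNormalizer (P, e)).subgroupOf
          (BlockFusion.pairNormalizer (P, BlockFusion.tilde K e))) ∧
      -- for every `g₀` whose coset generates this quotient, and `σ = c_{g₀}`
      ∀ g₀ : BlockFusion.pairNormalizer (P, BlockFusion.tilde K e),
        Subgroup.zpowers (QuotientGroup.mk g₀ :
          BlockFusion.pairNormalizer (P, BlockFusion.tilde K e) ⧸
            (BlockFusion.pairNormalizer (P, e)).subgroupOf
              (BlockFusion.pairNormalizer (P, BlockFusion.tilde K e))) = ⊤ →
        ∀ σ : MulAut P, σ = BlockFusion.conjAut (P, BlockFusion.tilde K e) g₀ →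
        ∀ F Ftilde : BlockFusion.HomFamily P, F = BlockFusion.blockFusion p (P, e) →
          Ftilde = BlockFusion.blockFusion p (P, BlockFusion.tilde K e) →
          Ftilde = BlockFusion.generated F σ ∧
          BlockFusion.MemAut Ftilde σ ∧
          ∀ (Q R : Subgroup P), ∀ φ ∈ Ftilde Q R,
            ∃ i : ℤ,
              ∃ ψ ∈ F Q (R.map (σ ^ (-i)).toMonoidHom),
              ∃ ψ' ∈ F (Q.map (σ ^ i).toMonoidHom) R,
                φ = (BlockFusion.restrictAut (σ ^ i) (R.map (σ ^ (-i)).toMonoidHom) R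
                      (BlockFusion.map_zpow_neg_le σ i R)).comp ψ ∧
                φ = ψ'.comp (BlockFusion.restrictAut (σ ^ i) Q
                      (Q.map (σ ^ i).toMonoidHom) le_rfl) := by 
  have : CharP L p := charP_of_injective_algebraMap (algebraMap K L).injective p
  have he : BlockFusion.IsBrauerPair p (P, e) := hPe.1.1
  refine ⟨hb.tilde, hPe.tildePair hb, BlockFusion.pairNormalizer_le_tildePair he,
    BlockFusion.pairNormalizer_subgroupOf_normal he, ?_, ?_⟩
  · have hnormal := BlockFusion.pairNormalizer_subgroupOf_normal (K := K) he
    exact BlockFusion.isCyclic_pairNormalizer_quotient he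
  · have hnormal : ((BlockFusion.pairNormalizer (P, e)).subgroupOf
        (BlockFusion.pairNormalizer (P, BlockFusion.tilde K e))).Normal :=
      BlockFusion.pairNormalizer_subgroupOf_normal he
    rintro g₀ hg₀ σ hσ F Ft rfl rfl
    refine ⟨BlockFusion.blockFusion_tilde_eq_generated hb hPe hg₀ hσ, ?_, ?_⟩
    · rw [hσ]
      exact BlockFusion.memAut_conjAut he.tildePair g₀
    · intro Q R φ hφ
      exact BlockFusion.exists_comp_restrictAut hb hPe hg₀ hσ hφ
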